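/- There is a universal constant $K>0$ such that the following holds. Let $n\ge 2$, $d\ge 1$. For each user $i\in\{1,\dots,n\}$ let $\mathcal D_i$ be a probability distribution on a sample space $\Xi$, let $\ell:\mathbb R^d\times\Xi\to\mathbb R$ be a loss that is differentiable in its first argument and integrable under every $\mathcal D_i$ in its second one, and put $f_i(x)=\mathbb E_{\xi\sim\mathcal D_i}[\ell(x;\xi)]$ and $f=\frac1n\sum_{i=1}^n f_i$. Let $\nabla$ denote the gradient in $x$ and $\|\cdot\|$ the Euclidean norm. Assume: (A1) $W=(w_{ij})\in\mathbb R^{n\times n}$ is primitive and doubly stochastic; $\lambda$ denotes its second largest singular value. (A2) $f^\star=\inf_x f(x)>-\infty$. (A3) Each $f_i$ is differentiable and $\|\nabla f_i(x)-\nabla f_i(y)\|\le L\|x-y\|$ for all $x,y\in\mathbb R^d$. (A4) The samples $\xi_i^t\sim\mathcal D_i$ ($1\le i\le n$, $t\ge1$) are independent across users and iterations; for all $i$ and $x\in\mathbb R^d$, $\mathbb E_{\xi\sim\mathcal D_i}[\nabla\ell(x;\xi)]=\nabla f_i(x)$, and the noise is $\sigma_i$-sub-Gaussian, $\mathbb E_{\xi\sim\mathcal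 D_i}\big[\exp\big(\|\nabla\ell(x;\xi)-\nabla f_i(x)\|^2/\sigma_i^2\big)\big]\le \exp(1)$, where $\sigma_i\ge0$ (for $\sigma_i=0$ this means that the noise vanishes almost surely). Put $\sigma^2=\frac1n\sum_i\sigma_i^2$ with $\sigma\ge 0$, and $\overline\sigma=\max_i\sigma_i$. (A5) For some $A,B\ge0$ and all $x\in\mathbb R^d$, $\max_i\|\nabla f_i(x)\|^2\le A^2+B^2\|\nabla f(x)\|^2$. If $\sigma=0$, assume also $A=0$. From deterministic initial models $x_1^1,\dots,x_n^1\in\mathbb R^d$, run decentralized SGD with a fixed step-size $\alpha$, $$x_i^{t+1}=\sum_{j=1}^n w_{ij}\big(x_j^t-\alpha\nabla\ell(x_j^t;\xi_j^t)\big),\qquad t\ge1 .$$ Put $\overline x^1=\frac1n\sum_i x_i^1$, $\Delta_f=f(\overline x^1)-f^\star$, $\Delta_x=\frac1n\sum_i\|x_i^1-\overline x^1\|^2$. Let $T\ge1$ and $\alpha=\min\big\{C,\frac{\sqrt n}{\sigma\sqrt{dT}}\big\}$ (with $\alpha=C$ if $\sigma=0$), where $C>0$ satisfies $$C\le\min\Big\{\frac1{2L},\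 \frac n{9\sigma^2},\ \frac{1-\lambda}{\lambda LB\sqrt{48}},\ \frac{\sqrt n}{6\sigma\sqrt{10dL}},\ \frac{\sqrt[3]{n}\,(1-\lambda)^{2/3}}{\overline\sigma^{2/3}\lambda^{2/3}L^{2/3}\sqrt[3]9}\Big\},$$ each inequality $C\le p/q$ being read as $qC\le p$. Then for every $\delta\in(0,1)$, with probability at least $1-\delta$, $$\frac1{nT}\sum_{t=1}^T\sum_{i=1}^n\|\nabla f(x_i^t)\|^2\le K\bigg(\frac{\sigma\sqrt d\,(\Delta_f+\log\frac1\delta+L)}{\sqrt{nT}}+\frac{\Delta_f+\log\frac1\delta}{CT}+\frac{L^2\Delta_x}{(1-\lambda^2)T}+\frac{n\lambda^2L^2(A^2+\sigma^2)}{\sigma^2d(1-\lambda)^2T}\bigg),$$ where a quotient with zero denominator (which occurs only if $\sigma=0$ or $\lambda=1$) is read as $0$. -/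

import Mathlib

open MeasureTheory ProbabilityTheory

noncomputable section

namespace DSGD

/-- The model space `ℝ^d` with the Euclidean norm. -/
abbrev Vec (d : ℕ) : Type := EuclideanSpace ℝ (Fin d)

variable {n d : ℕ} {Ξ Ω : Type*} [MeasurableSpace Ξ] [MeasurableSpace Ω]

/-- The network average `(1/n) ∑ᵢ xᵢ` of the users' models. -/
def avg (x : Fin n → Vec d) : Vec d := (n : ℝ)⁻¹ • ∑ i, x i

/-- The local cost `fᵢ(x) = 𝔼_{ξ ∼ 𝒟ᵢ} ℓ(x; ξ)` of user `i`. -/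
def localCost (ℓ : Vec d → Ξ → ℝ) (D : Fin n → Measure Ξ) (i : Fin n) (x : Vec d) : ℝ :=
  ∫ s, ℓ x s ∂(D i)

/-- The global cost `f = (1/n) ∑ᵢ fᵢ`. -/
def globalCost (ℓ : Vec d → Ξ → ℝ) (D : Fin n → Measure Ξ) (x : Vec d) : ℝ :=
  (n : ℝ)⁻¹ * ∑ i, localCost ℓ D i x

/-- The stochastic gradient `∇ℓ(x; ξ)`, the gradient being taken in `x`. -/
def stochGrad (ℓ : Vec d → Ξ → ℝ) (x : Vec d) (s : Ξ) : Vec d :=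
  gradient (fun y => ℓ y s) x

/-- The stochastic noise `∇ℓ(x; ξ) - ∇fᵢ(x)` of user `i` at the point `x`. -/
def noise (ℓ : Vec d → Ξ → ℝ) (D : Fin n → Measure Ξ) (i : Fin n) (x : Vec d) (s : Ξ) : Vec d :=
  stochGrad ℓ x s - gradient (localCost ℓ D i) x

/-- The iterates of decentralized SGD in the adapt-then-combine form, for weights `W`, step-sizes
`α`, initial models `x₁` and one realization `ξ i t` of the samples:
`x_i^{t+1} = ∑_j w_ij (x_j^t - α_t ∇ℓ(x_j^t; ξ_j^t))`.
Time is counted from `0`: `iter … 0` is the initial model, so that the first `T` iterates are those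
with index in `Finset.range T`. Users that are not neighbours of `i` have weight `w_ij = 0`. -/
def iter (ℓ : Vec d → Ξ → ℝ) (W : Matrix (Fin n) (Fin n) ℝ) (α : ℕ → ℝ) (x₁ : Fin n → Vec d)
    (ξ : Fin n → ℕ → Ξ) : ℕ → Fin n → Vec d
  | 0 => x₁
  | t + 1 => fun i => ∑ j, W i j •
      (iter ℓ W α x₁ ξ t j - α t • stochGrad ℓ (iter ℓ W α x₁ ξ t j) (ξ j t))

/-- The random vector `Z` is `s`-sub-Gaussian under `ν`: `𝔼 exp(‖Z‖² / s²) ≤ exp 1`, which for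
`s = 0` means that `Z` vanishes almost surely. -/
def IsSubGaussian (ν : Measure Ξ) (Z : Ξ → Vec d) (s : ℝ) : Prop :=
  if s = 0 then ∀ᵐ a ∂ν, Z a = 0
  else ∫⁻ a, ENNReal.ofReal (Real.exp (‖Z a‖ ^ 2 / s ^ 2)) ∂ν ≤ ENNReal.ofReal (Real.exp 1)

/-- The second largest singular value of a square matrix (Mathlib lists the singular values in
decreasing order, with multiplicity, starting from index `0`). -/
def secondSingularValue (W : Matrix (Fin n) (Fin n) ℝ) : ℝ :=
  (Matrix.toEuclideanLin W).singularValues 1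

/-- The communication matrix is primitive and doubly stochastic. -/
structure IsCommunicationMatrix (W : Matrix (Fin n) (Fin n) ℝ) : Prop where
  primitive : W.IsPrimitive
  doublyStochastic : W ∈ doublyStochastic ℝ (Fin n)

/-- The stochastic first-order oracle is well defined: the samples of each user have a probability
distribution, the loss is integrable in the sample and differentiable in the model, and its
gradient is a jointly measurable function. -/
structure IsOracle (ℓ : Vec d → Ξ → ℝ) (D : Fin n → Measure Ξ) : Prop where
  prob : ∀ i, IsProbabilityMeasure (D i)
  integrable : ∀ i x, Integrable (ℓ x) (D i)
  differentiable : ∀ s, Differentiable ℝ (fun x => ℓ x s)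
  measurable : Measurable (fun p : Vec d × Ξ => stochGrad ℓ p.1 p.2)

/-- Each local cost is differentiable with `L`-Lipschitz gradient. -/
structure SmoothCosts (ℓ : Vec d → Ξ → ℝ) (D : Fin n → Measure Ξ) (L : ℝ) : Prop where
  nonneg : 0 ≤ L
  differentiable : ∀ i, Differentiable ℝ (localCost ℓ D i)
  lipschitz : ∀ i x y,
    ‖gradient (localCost ℓ D i) x - gradient (localCost ℓ D i) y‖ ≤ L * ‖x - y‖

/-- The samples `ξ i t` have law `D i` and are independent across users and iterations. -/
structure IsSampling (μ : Measure Ω) (D : Fin n → Measure Ξ) (ξ : Fin n → ℕ → Ω → Ξ) : Prop where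
  measurable : ∀ i t, Measurable (ξ i t)
  law : ∀ i t, μ.map (ξ i t) = D i
  indep : iIndepFun (fun p : Fin n × ℕ => ξ p.1 p.2) μ

/-- The stochastic gradients are unbiased and the noise of user `i` is `σᵢ`-sub-Gaussian, at every
point. The sample used in iteration `t` has law `D i` and is independent of the past `ℱ_t`, so this
is the conditional statement given `ℱ_t` at the `ℱ_t`-measurable points. -/
structure IsUnbiasedSubGaussian (ℓ : Vec d → Ξ → ℝ) (D : Fin n → Measure Ξ) (σ : Fin n → ℝ) :
    Prop where
  nonneg : ∀ i, 0 ≤ σ i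
  integrable : ∀ i x, Integrable (stochGrad ℓ x) (D i)
  unbiased : ∀ i x, ∫ s, stochGrad ℓ x s ∂(D i) = gradient (localCost ℓ D i) x
  subGaussian : ∀ i x, IsSubGaussian (D i) (noise ℓ D i x) (σ i)

/-- Bounded heterogeneity: `maxᵢ ‖∇fᵢ(x)‖² ≤ A² + B² ‖∇f(x)‖²`. -/
structure BoundedHeterogeneity (ℓ : Vec d → Ξ → ℝ) (D : Fin n → Measure Ξ) (A B : ℝ) : Prop where
  nonneg_A : 0 ≤ A
  nonneg_B : 0 ≤ B
  bound : ∀ i x,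
    ‖gradient (localCost ℓ D i) x‖ ^ 2 ≤ A ^ 2 + B ^ 2 * ‖gradient (globalCost ℓ D) x‖ ^ 2

/-- The average noise parameter `σ`, where `σ² = (1/n) ∑ᵢ σᵢ²`. -/
def sigmaAvg (σ : Fin n → ℝ) : ℝ := Real.sqrt ((n : ℝ)⁻¹ * ∑ i, σ i ^ 2)

/-- The largest noise parameter `maxᵢ σᵢ`. -/
def sigmaMax (σ : Fin n → ℝ) : ℝ := ⨆ i, σ i

/-- The initial optimality gap `Δ_f = f(x̄¹) - inf f`. -/
def gapF (ℓ : Vec d → Ξ → ℝ) (D : Fin n → Measure Ξ) (x₁ : Fin n → Vec d) : ℝ :=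
  globalCost ℓ D (avg x₁) - ⨅ x, globalCost ℓ D x

/-- The initial consensus gap `Δ_x = (1/n) ∑ᵢ ‖xᵢ¹ - x̄¹‖²`. -/
def gapX (x₁ : Fin n → Vec d) : ℝ := (n : ℝ)⁻¹ * ∑ i, ‖x₁ i - avg x₁‖ ^ 2

/-- The condition `C ≤ min {1/(2L), n/(9σ²), (1-λ)/(λLB√48), √n/(6σ√(10dL)),
n^{1/3}(1-λ)^{2/3}/(9^{1/3} σ̄^{2/3} λ^{2/3} L^{2/3})}` on a constant `C > 0`, cleared of
denominators (a vanishing denominator imposes no upper bound when the numerator is positive). -/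
structure StepBound (n d : ℕ) (L B lam σ σmax C : ℝ) : Prop where
  pos : 0 < C
  smooth : 2 * L * C ≤ 1
  noise : 9 * σ ^ 2 * C ≤ n
  network : lam * L * B * Real.sqrt 48 * C ≤ 1 - lam
  dim : 6 * σ * Real.sqrt (10 * d * L) * C ≤ Real.sqrt n
  networkNoise :
    σmax ^ (2 / 3 : ℝ) * lam ^ (2 / 3 : ℝ) * L ^ (2 / 3 : ℝ) * (9 : ℝ) ^ (1 / 3 : ℝ) * C
      ≤ (n : ℝ) ^ (1 / 3 : ℝ) * (1 - lam) ^ (2 / 3 : ℝ)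

/-- The step-size `min {C, √n / (σ √(dT))}`, which is `C` if `σ = 0`. -/
def stepSize (n d T : ℕ) (σ C : ℝ) : ℝ :=
  if σ = 0 then C else min C (Real.sqrt n / (σ * Real.sqrt (d * T)))

/-- The average `(1/(nT)) ∑_{t ≤ T} ∑ᵢ ‖∇f(xᵢᵗ)‖²` along a sequence of models. -/
def avgGradSq (ℓ : Vec d → Ξ → ℝ) (D : Fin n → Measure Ξ) (T : ℕ) (x : ℕ → Fin n → Vec d) : ℝ :=
  ((n : ℝ) * T)⁻¹ * ∑ t ∈ Finset.range T, ∑ i, ‖gradient (globalCost ℓ D) (x t i)‖ ^ 2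

/-- The rate of convergence. -/
def rate (n d T : ℕ) (L A lam σ C Δf Δx δ : ℝ) : ℝ :=
  σ * Real.sqrt d * (Δf + Real.log (1 / δ) + L) / Real.sqrt (n * T)
    + (Δf + Real.log (1 / δ)) / (C * T)
    + L ^ 2 * Δx / ((1 - lam ^ 2) * T)
    + n * lam ^ 2 * L ^ 2 * (A ^ 2 + σ ^ 2) / (σ ^ 2 * d * (1 - lam) ^ 2 * T)

end DSGD

end

/-! The proof is a potential argument in which the noise forms an exponential supermartingale. The
network average `x̄` follows a perturbed gradient descent for `f`. Its gradients are evaluated at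
the users' models, which costs at most `L²` times the consensus gap, and its noise is the average
`z̄` of the users' noises. The consensus gap contracts by the factor `λ` and is fed by `a² λ² / (1 -
λ)` times the mean squared stochastic gradient. Hence `f(x̄)` plus a multiple of `a L² / (1 - λ)`
times the gap decreases by a multiple of `a · mean ‖∇f(xᵢ)‖²`, up to a constant and noise terms
(`potential_mixStep_le`).

The noise enters in three ways: linearly through `⟨∇f(x̄), z̄⟩`, through `‖z̄‖²`, and through `∑
‖zᵢ‖²` by way of the gap. From each, a bound on its logarithmic moment generating function is
subtracted. The compensator of the linear part is proportional to `a² σ² ‖∇f(x̄)‖² / n`, so the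
descent absorbs it and no bound on the gradients is needed. Averaging independent noises keeps the
factor `1 / n` in the first two parts. Given the past, the compensated noise has exponential moment
at most one (`lintegral_pi_exp_noiseTerm_le_one`). Independence across iterations passes this to the
sum (`lintegral_exp_sum_stepNoise_le_one`), and Markov's inequality bounds the sum by `log (1/δ)` on
a single event.

On that event the potential telescopes, and dividing by `a T` gives the rate (`le_rate`). The case
`λ = 1` is separate: it can occur for primitive `W`, since `WᵀW` may be reducible, but the step-size
conditions then force `∇f = 0`. -/

noncomputable section

namespace DSGD

/-! ### Contraction by the second singular value -/

section SpectralGap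

open Module InnerProductSpace

variable {E : Type*} [NormedAddCommGroup E] [InnerProductSpace ℝ E] [FiniteDimensional ℝ E]

/-- A contraction `T` is bounded by its second singular value on the orthogonal complement of a
nonzero vector fixed by `T† T`. -/
theorem norm_apply_le_singularValues_one (T : E →ₗ[ℝ] E) (hT : ∀ x, ‖T x‖ ≤ ‖x‖)
    (hE : 1 < finrank ℝ E) {e u : E} (he : e ≠ 0) (hfix : LinearMap.adjoint T (T e) = e)
    (hu : inner ℝ e u = 0) : ‖T u‖ ≤ T.singularValues 1 * ‖u‖ := by
  set hS := T.isSymmetric_adjoint_comp_self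
  set b := hS.eigenvectorBasis rfl
  set ev := hS.eigenvalues rfl
  have hb : ∀ k, LinearMap.adjoint T (T (b k)) = ev k • b k := fun k =>
    hS.apply_eigenvectorBasis rfl k
  let k0 : Fin (finrank ℝ E) := ⟨0, by omega⟩
  let k1 : Fin (finrank ℝ E) := ⟨1, hE⟩
  have hanti : Antitone ev := hS.eigenvalues_antitone rfl
  have hSb : ∀ k x, inner ℝ (b k) (LinearMap.adjoint T (T x)) = ev k * inner ℝ (b k) x := by
    intro k x
    rw [LinearMap.adjoint_inner_right, ← LinearMap.adjoint_inner_left, hb, inner_smul_left]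
    simp
  have hnorm : ∀ x, ‖T x‖ ^ 2 = ∑ k, ev k * inner ℝ (b k) x ^ 2 := by
    intro x
    rw [← real_inner_self_eq_norm_sq, ← LinearMap.adjoint_inner_right, ← b.sum_inner_mul_inner]
    refine Finset.sum_congr rfl fun k _ => ?_
    rw [hSb, real_inner_comm]; ring
  have hle1 : ev k0 ≤ 1 := by
    have h1 : ‖T (b k0)‖ ^ 2 = ev k0 := by
      rw [← real_inner_self_eq_norm_sq, ← LinearMap.adjoint_inner_right, hb, inner_smul_right,
        real_inner_self_eq_norm_sq, b.norm_eq_one]; simp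
    have h2 := hT (b k0)
    rw [b.norm_eq_one] at h2
    rw [← h1]; exact pow_le_one₀ (norm_nonneg _) h2
  -- If `ev k1 < 1`, the fixed vector `e` is orthogonal to every `b k` with `k ≠ k0`, so `e` spans
  -- the top eigenline and `u` has no component there. Otherwise `ev k0 ≤ 1 ≤ ev k1`, and the top
  -- eigenvalue does no harm.
  have hk0 : ev k0 ≤ ev k1 ∨ inner ℝ (b k0) u = 0 := by
    by_cases h : 1 ≤ ev k1
    · exact Or.inl (hle1.trans h)
    right
    have hz : ∀ k, k ≠ k0 → inner ℝ (b k) e = 0 := by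
      intro k hk
      have hk1 : k1 ≤ k := by
        rw [Fin.le_def]
        have : k.val ≠ 0 := fun h0 => hk (Fin.ext h0)
        change 1 ≤ k.val
        omega
      have h3 := hSb k e
      rw [hfix] at h3
      have h4 : (ev k - 1) * inner ℝ (b k) e = 0 := by linarith
      rcases mul_eq_zero.1 h4 with h5 | h5
      · have := hanti hk1
        exact absurd (by linarith) h
      · exact h5
    have h6 := b.sum_inner_mul_inner e u
    rw [hu, Finset.sum_eq_single k0 (fun k _ hk => by rw [real_inner_comm, hz k hk, zero_mul])
      (by simp)] at h6
    rcases mul_eq_zero.1 h6 with h7 | h7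
    · exfalso
      apply he
      rw [← norm_eq_zero, ← sq_eq_zero_iff, ← real_inner_self_eq_norm_sq, ← b.sum_inner_mul_inner]
      refine Finset.sum_eq_zero fun k _ => ?_
      by_cases hk : k = k0
      · rw [hk, h7, zero_mul]
      · rw [hz k hk, mul_zero]
    · exact h7
  refine le_of_sq_le_sq ?_ (mul_nonneg (T.singularValues_nonneg 1) (norm_nonneg u))
  have hsv : T.singularValues 1 ^ 2 = ev k1 := T.sq_singularValues_fin rfl k1
  rw [mul_pow, hsv, hnorm, ← real_inner_self_eq_norm_sq u, ← b.sum_inner_mul_inner, Finset.mul_sum]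
  refine Finset.sum_le_sum fun k _ => ?_
  rw [real_inner_comm, ← sq]
  by_cases hk : k = k0
  · rcases hk0 with h | h
    · rw [hk]; exact mul_le_mul_of_nonneg_right h (sq_nonneg _)
    · rw [hk, real_inner_comm, h]; simp
  · refine mul_le_mul_of_nonneg_right (hanti ?_) (sq_nonneg _)
    rw [Fin.le_def]
    have : k.val ≠ 0 := fun h0 => hk (Fin.ext h0)
    change 1 ≤ k.val
    omega

variable {n d : ℕ}

/-- Jensen for the square in each row, then the column sums. -/
theorem norm_toEuclideanLin_le_of_mem_doublyStochastic {W : Matrix (Fin n) (Fin n) ℝ}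
    (hW : W ∈ doublyStochastic ℝ (Fin n)) (u : EuclideanSpace ℝ (Fin n)) :
    ‖Matrix.toEuclideanLin W u‖ ≤ ‖u‖ := by
  refine le_of_sq_le_sq ?_ (norm_nonneg u)
  rw [EuclideanSpace.real_norm_sq_eq, EuclideanSpace.real_norm_sq_eq]
  calc ∑ i, (Matrix.toEuclideanLin W u) i ^ 2 ≤ ∑ i, ∑ j, W i j * u j ^ 2 := by
        refine Finset.sum_le_sum fun i _ => ?_
        have := Real.pow_arith_mean_le_arith_mean_pow_of_even Finset.univ (W i) u
          (fun j _ => nonneg_of_mem_doublyStochastic hW) (sum_row_of_mem_doublyStochastic hW i)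
          (n := 2) even_two
        simpa [Matrix.toLpLin_apply, Matrix.mulVec, dotProduct] using this
    _ = ∑ j, u j ^ 2 := by
        rw [Finset.sum_comm]
        simp_rw [← Finset.sum_mul, sum_col_of_mem_doublyStochastic hW, one_mul]

/-- The all-ones vector is fixed by both `W` and `Wᵀ`, so it serves as the vector `e` above. -/
theorem norm_toEuclideanLin_le_secondSingularValue {W : Matrix (Fin n) (Fin n) ℝ} (hn : 2 ≤ n)
    (hW : W ∈ doublyStochastic ℝ (Fin n)) (u : EuclideanSpace ℝ (Fin n)) (hu : ∑ i, u i = 0) :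
    ‖Matrix.toEuclideanLin W u‖ ≤ secondSingularValue W * ‖u‖ := by
  have : Nonempty (Fin n) := ⟨⟨0, by omega⟩⟩
  refine norm_apply_le_singularValues_one (Matrix.toEuclideanLin W)
    (norm_toEuclideanLin_le_of_mem_doublyStochastic hW) (by rw [finrank_euclideanSpace_fin]; omega)
    (e := WithLp.toLp 2 (1 : Fin n → ℝ)) ?_ ?_ ?_
  · intro h
    have := congrArg (fun v : EuclideanSpace ℝ (Fin n) => v ⟨0, by omega⟩) h
    simp at this
  · have h1 : Matrix.toEuclideanLin W (WithLp.toLp 2 (1 : Fin n → ℝ)) = WithLp.toLp 2 1 := by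
      rw [Matrix.toLpLin_toLp, Matrix.toLin'_apply, mulVec_one_of_mem_doublyStochastic hW]
    rw [h1, ← Matrix.toEuclideanLin_conjTranspose_eq_adjoint, Matrix.toLpLin_toLp,
      Matrix.conjTranspose_eq_transpose_of_trivial, Matrix.toLin'_apply, Matrix.mulVec_transpose,
      one_vecMul_of_mem_doublyStochastic hW]
  · simpa [PiLp.inner_apply] using hu

theorem secondSingularValue_nonneg (W : Matrix (Fin n) (Fin n) ℝ) : 0 ≤ secondSingularValue W :=
  LinearMap.singularValues_nonneg _ 1

/-- Mixing with a doubly stochastic matrix contracts configurations of vectors of zero mean. -/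
theorem sum_norm_sq_mix_le {W : Matrix (Fin n) (Fin n) ℝ} (hn : 2 ≤ n)
    (hW : W ∈ doublyStochastic ℝ (Fin n)) (y : Fin n → Vec d) (hy : ∑ i, y i = 0) :
    ∑ i, ‖∑ j, W i j • y j‖ ^ 2 ≤ secondSingularValue W ^ 2 * ∑ i, ‖y i‖ ^ 2 := by
  simp_rw [EuclideanSpace.real_norm_sq_eq]
  -- Mixing acts on each of the `d` coordinates separately, so the scalar bound applies coordinate
  -- by coordinate.
  rw [Finset.sum_comm, Finset.sum_comm (f := fun i k => y i k ^ 2), Finset.mul_sum]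
  refine Finset.sum_le_sum fun k _ => ?_
  have h := norm_toEuclideanLin_le_secondSingularValue hn hW (WithLp.toLp 2 fun i => y i k) (by
    simpa using congrArg (fun v : Vec d => v k) hy)
  have h2 := pow_le_pow_left₀ (norm_nonneg _) h 2
  rw [mul_pow, EuclideanSpace.real_norm_sq_eq, EuclideanSpace.real_norm_sq_eq] at h2
  simpa [Matrix.toLpLin_apply, Matrix.mulVec, dotProduct] using h2

end SpectralGap

/-! ### One-step analysis for an arbitrary noise realization -/

section Deterministic

open Set

variable {n d : ℕ} {Ξ : Type*} [MeasurableSpace Ξ]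

/-- A function with `L`-Lipschitz gradient lies below its quadratic upper models. -/
theorem le_quadratic_of_lipschitz_gradient {f : Vec d → ℝ} {L : ℝ} (hf : Differentiable ℝ f)
    (hL : ∀ x y, ‖gradient f x - gradient f y‖ ≤ L * ‖x - y‖) (x h : Vec d) :
    f (x + h) ≤ f x + inner ℝ (gradient f x) h + L / 2 * ‖h‖ ^ 2 := by
  -- The excess over the quadratic model along the segment; the Lipschitz bound makes its derivative
  -- nonpositive.
  let ψ : ℝ → ℝ := fun t => f (x + t • h) - t * inner ℝ (gradient f x) h - L / 2 * t ^ 2 * ‖h‖ ^ 2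
  have hψ : ∀ t, HasDerivAt ψ
      (inner ℝ (gradient f (x + t • h)) h - inner ℝ (gradient f x) h - L * t * ‖h‖ ^ 2) t := by
    intro t
    have h1 : HasDerivAt (fun t : ℝ => x + t • h) h t := by
      simpa using ((hasDerivAt_id t).smul_const h).const_add x
    have h2 := ((hf (x + t • h)).hasGradientAt.hasFDerivAt).comp_hasDerivAt t h1
    have h3 : HasDerivAt (fun t : ℝ => t * inner ℝ (gradient f x) h)
        (inner ℝ (gradient f x) h) t := by
      simpa using (hasDerivAt_id t).mul_const (inner ℝ (gradient f x) h)
    have h4 : HasDerivAt (fun t : ℝ => L / 2 * t ^ 2 * ‖h‖ ^ 2) (L * t * ‖h‖ ^ 2) t := by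
      have := (((hasDerivAt_id t).pow 2).const_mul (L / 2)).mul_const (‖h‖ ^ 2)
      exact this.congr_deriv (by push_cast [id]; ring)
    exact (h2.sub h3).sub h4
  have hanti : AntitoneOn ψ (Icc 0 1) := by
    refine antitoneOn_of_deriv_nonpos (convex_Icc 0 1)
      (fun t _ => (hψ t).continuousAt.continuousWithinAt)
      (fun t _ => (hψ t).differentiableAt.differentiableWithinAt) fun t ht => ?_
    rw [interior_Icc] at ht
    rw [(hψ t).deriv, ← inner_sub_left]
    have h1 := real_inner_le_norm (gradient f (x + t • h) - gradient f x) h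
    have h2 := hL (x + t • h) x
    rw [add_sub_cancel_left, norm_smul, Real.norm_of_nonneg ht.1.le] at h2
    nlinarith [mul_le_mul_of_nonneg_right h2 (norm_nonneg h)]
  have h01 := hanti (left_mem_Icc.2 zero_le_one) (right_mem_Icc.2 zero_le_one) zero_le_one
  simp only [ψ, one_smul, zero_smul, add_zero] at h01
  linarith

theorem hasGradientAt_globalCost {ℓ : Vec d → Ξ → ℝ} {D : Fin n → Measure Ξ} {L : ℝ}
    (hS : SmoothCosts ℓ D L) (x : Vec d) :
    HasGradientAt (globalCost ℓ D) (avg fun i => gradient (localCost ℓ D i) x) x := by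
  rw [hasGradientAt_iff_hasFDerivAt]
  have h := (HasFDerivAt.fun_sum (u := Finset.univ) fun i _ =>
    (hS.differentiable i x).hasGradientAt.hasFDerivAt).const_mul ((n : ℝ)⁻¹)
  refine h.congr_fderiv ?_
  ext y
  simp [avg]

theorem gradient_globalCost {ℓ : Vec d → Ξ → ℝ} {D : Fin n → Measure Ξ} {L : ℝ}
    (hS : SmoothCosts ℓ D L) (x : Vec d) :
    gradient (globalCost ℓ D) x = avg fun i => gradient (localCost ℓ D i) x :=
  (hasGradientAt_globalCost hS x).gradient

theorem avg_add (x y : Fin n → Vec d) : avg (fun i => x i + y i) = avg x + avg y := by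
  simp [avg, Finset.sum_add_distrib]

theorem avg_sub (x y : Fin n → Vec d) : avg (fun i => x i - y i) = avg x - avg y := by
  simp [avg, Finset.sum_sub_distrib, smul_sub]

theorem avg_smul (a : ℝ) (x : Fin n → Vec d) : avg (fun i => a • x i) = a • avg x := by
  simp [avg, ← Finset.smul_sum, smul_comm a]

theorem sum_eq_smul_avg (hn : 0 < n) (x : Fin n → Vec d) : ∑ i, x i = (n : ℝ) • avg x := by
  rw [avg, smul_inv_smul₀ (by positivity)]

theorem norm_avg_sq_le (hn : 0 < n) (x : Fin n → Vec d) :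
    ‖avg x‖ ^ 2 ≤ (n : ℝ)⁻¹ * ∑ i, ‖x i‖ ^ 2 := by
  have hn' : (0 : ℝ) < n := by positivity
  have h1 : ‖∑ i, x i‖ ^ 2 ≤ n * ∑ i, ‖x i‖ ^ 2 := by
    calc ‖∑ i, x i‖ ^ 2 ≤ (∑ i, ‖x i‖) ^ 2 :=
          pow_le_pow_left₀ (norm_nonneg _) (norm_sum_le _ _) 2
      _ ≤ n * ∑ i, ‖x i‖ ^ 2 := by
          simpa using sq_sum_le_card_mul_sum_sq (s := Finset.univ) (f := fun i => ‖x i‖)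
  rw [avg, norm_smul, mul_pow, Real.norm_of_nonneg (by positivity)]
  calc ((n : ℝ)⁻¹) ^ 2 * ‖∑ i, x i‖ ^ 2 ≤ ((n : ℝ)⁻¹) ^ 2 * (n * ∑ i, ‖x i‖ ^ 2) := by gcongr
    _ = (n : ℝ)⁻¹ * ∑ i, ‖x i‖ ^ 2 := by field_simp

theorem sum_norm_sub_avg_sq_le (hn : 0 < n) (x : Fin n → Vec d) :
    ∑ i, ‖x i - avg x‖ ^ 2 ≤ ∑ i, ‖x i‖ ^ 2 := by
  have h : ∑ i, ‖x i - avg x‖ ^ 2 = ∑ i, ‖x i‖ ^ 2 - n * ‖avg x‖ ^ 2 := by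
    simp_rw [norm_sub_sq_real]
    rw [Finset.sum_add_distrib, Finset.sum_sub_distrib, ← Finset.mul_sum, ← sum_inner,
      sum_eq_smul_avg hn x, inner_smul_left, real_inner_self_eq_norm_sq]
    simp; ring
  rw [h]
  have : 0 ≤ (n : ℝ) * ‖avg x‖ ^ 2 := by positivity
  linarith

theorem norm_gradient_globalCost_sub_le (hn : 0 < n) {ℓ : Vec d → Ξ → ℝ} {D : Fin n → Measure Ξ}
    {L : ℝ} (hS : SmoothCosts ℓ D L) (x y : Vec d) :
    ‖gradient (globalCost ℓ D) x - gradient (globalCost ℓ D) y‖ ≤ L * ‖x - y‖ := by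
  rw [gradient_globalCost hS, gradient_globalCost hS, ← avg_sub]
  refine le_of_sq_le_sq ?_ (mul_nonneg hS.nonneg (norm_nonneg _))
  refine (norm_avg_sq_le hn _).trans ?_
  calc (n : ℝ)⁻¹ * ∑ i, ‖gradient (localCost ℓ D i) x - gradient (localCost ℓ D i) y‖ ^ 2
      ≤ (n : ℝ)⁻¹ * ∑ _i : Fin n, (L * ‖x - y‖) ^ 2 := by
        gcongr with i
        exact hS.lipschitz i x y
    _ = (L * ‖x - y‖) ^ 2 := by
        have : (n : ℝ) ≠ 0 := by positivity
        simp; field_simp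

/-- One step of the network dynamics: mixing of `xⱼ - a gⱼ` with the weights `W`. -/
def mixStep (W : Matrix (Fin n) (Fin n) ℝ) (a : ℝ) (x g : Fin n → Vec d) : Fin n → Vec d :=
  fun i => ∑ j, W i j • (x j - a • g j)

theorem avg_mixStep {W : Matrix (Fin n) (Fin n) ℝ} (hW : W ∈ doublyStochastic ℝ (Fin n)) (a : ℝ)
    (x g : Fin n → Vec d) : avg (mixStep W a x g) = avg x - a • avg g := by
  rw [← avg_smul, ← avg_sub, avg, avg]
  simp only [mixStep]
  rw [Finset.sum_comm]
  simp_rw [← Finset.sum_smul, sum_col_of_mem_doublyStochastic hW, one_smul]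

theorem gapX_nonneg (x : Fin n → Vec d) : 0 ≤ gapX x := by
  unfold gapX; positivity

/-- Young's inequality, balanced so that `p²` keeps the factor `lam`: one of the two factors `lam`
is spent, and the price on `q²` is `1 / (1 - lam)`. The difference of the two sides is a perfect
square over `1 - lam`. -/
theorem sq_mul_add_sq_le {lam p q : ℝ} (h0 : 0 ≤ lam) (h1 : lam < 1) :
    lam ^ 2 * (p + q) ^ 2 ≤ lam * p ^ 2 + lam ^ 2 / (1 - lam) * q ^ 2 := by
  have h : 0 < 1 - lam := by linarith
  have : lam * p ^ 2 + lam ^ 2 / (1 - lam) * q ^ 2 - lam ^ 2 * (p + q) ^ 2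
      = lam * ((1 - lam) * p - lam * q) ^ 2 / (1 - lam) := by field_simp; ring
  have h2 : 0 ≤ lam * ((1 - lam) * p - lam * q) ^ 2 / (1 - lam) := by positivity
  linarith

/-- The consensus gap contracts, up to the size of the gradients. -/
theorem gapX_mixStep_le (hn : 2 ≤ n) {W : Matrix (Fin n) (Fin n) ℝ}
    (hW : W ∈ doublyStochastic ℝ (Fin n)) (hlam : secondSingularValue W < 1) {a : ℝ} (ha : 0 ≤ a)
    (x g : Fin n → Vec d) :
    gapX (mixStep W a x g) ≤ secondSingularValue W * gapX x
      + a ^ 2 * secondSingularValue W ^ 2 / (1 - secondSingularValue W)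
        * ((n : ℝ)⁻¹ * ∑ i, ‖g i‖ ^ 2) := by
  set lam := secondSingularValue W
  have hlam0 : 0 ≤ lam := secondSingularValue_nonneg W
  have hn0 : 0 < n := by omega
  have hlam1 : 0 < 1 - lam := by linarith
  -- The deviations of `xⱼ - a gⱼ` from their mean. Unit row sums make mixing commute with
  -- subtracting the mean.
  let y : Fin n → Vec d := fun j => (x j - avg x) - a • (g j - avg g)
  have hy : ∑ j, y j = 0 := by
    have h0 : ∀ u : Fin n → Vec d, ∑ j, (u j - avg u) = 0 := fun u => by
      rw [Finset.sum_sub_distrib, sum_eq_smul_avg hn0]; simp [Nat.cast_smul_eq_nsmul]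
    simp only [y]
    rw [Finset.sum_sub_distrib, ← Finset.smul_sum, h0, h0]; simp
  have hdev : ∀ i, mixStep W a x g i - avg (mixStep W a x g) = ∑ j, W i j • y j := by
    intro i
    have h1 : ∀ j, W i j • y j = W i j • (x j - a • g j) - W i j • (avg x - a • avg g) := by
      intro j
      rw [← smul_sub]; congr 1
      simp only [y, smul_sub]; abel
    simp_rw [h1]
    rw [Finset.sum_sub_distrib, ← Finset.sum_smul, sum_row_of_mem_doublyStochastic hW, one_smul,
      avg_mixStep hW]
    rfl
  have h1 : ∑ i, ‖mixStep W a x g i - avg (mixStep W a x g)‖ ^ 2 ≤ lam ^ 2 * ∑ i, ‖y i‖ ^ 2 := by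
    simp_rw [hdev]
    exact sum_norm_sq_mix_le hn hW y hy
  have h2 : lam ^ 2 * ∑ i, ‖y i‖ ^ 2 ≤ lam * ∑ i, ‖x i - avg x‖ ^ 2
      + lam ^ 2 / (1 - lam) * (a ^ 2 * ∑ i, ‖g i - avg g‖ ^ 2) := by
    rw [Finset.mul_sum, Finset.mul_sum, Finset.mul_sum, Finset.mul_sum, ← Finset.sum_add_distrib]
    refine Finset.sum_le_sum fun i _ => ?_
    have h3 : ‖y i‖ ≤ ‖x i - avg x‖ + a * ‖g i - avg g‖ := by
      refine (norm_sub_le _ _).trans ?_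
      rw [norm_smul, Real.norm_of_nonneg ha]
    calc lam ^ 2 * ‖y i‖ ^ 2 ≤ lam ^ 2 * (‖x i - avg x‖ + a * ‖g i - avg g‖) ^ 2 := by gcongr
      _ ≤ lam * ‖x i - avg x‖ ^ 2 + lam ^ 2 / (1 - lam) * (a * ‖g i - avg g‖) ^ 2 :=
        sq_mul_add_sq_le hlam0 hlam
      _ = _ := by ring
  have h3 := sum_norm_sub_avg_sq_le hn0 g
  have h4 : lam ^ 2 / (1 - lam) * (a ^ 2 * ∑ i, ‖g i - avg g‖ ^ 2)
      ≤ lam ^ 2 / (1 - lam) * (a ^ 2 * ∑ i, ‖g i‖ ^ 2) := by gcongr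
  unfold gapX
  calc (n : ℝ)⁻¹ * ∑ i, ‖mixStep W a x g i - avg (mixStep W a x g)‖ ^ 2
      ≤ (n : ℝ)⁻¹ * (lam * ∑ i, ‖x i - avg x‖ ^ 2
        + lam ^ 2 / (1 - lam) * (a ^ 2 * ∑ i, ‖g i‖ ^ 2)) := by
        gcongr; linarith
    _ = _ := by ring

theorem norm_add_sq_le_two_mul {E : Type*} [SeminormedAddCommGroup E] (x y : E) :
    ‖x + y‖ ^ 2 ≤ 2 * ‖x‖ ^ 2 + 2 * ‖y‖ ^ 2 := by
  have h := norm_add_le x y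
  nlinarith [norm_nonneg (x + y), norm_nonneg x, norm_nonneg y, sq_nonneg (‖x‖ - ‖y‖)]

variable {ℓ : Vec d → Ξ → ℝ} {D : Fin n → Measure Ξ} {L A B : ℝ}

/-- The gradient of the global cost at a user's model, compared with that at the network average. -/
theorem norm_gradient_globalCost_sq_le (hn : 0 < n) (hS : SmoothCosts ℓ D L) (x y : Vec d) :
    ‖gradient (globalCost ℓ D) x‖ ^ 2
      ≤ 2 * ‖gradient (globalCost ℓ D) y‖ ^ 2 + 2 * L ^ 2 * ‖x - y‖ ^ 2 := by
  have h := norm_add_sq_le_two_mul (gradient (globalCost ℓ D) y)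
    (gradient (globalCost ℓ D) x - gradient (globalCost ℓ D) y)
  rw [add_sub_cancel] at h
  have h2 := pow_le_pow_left₀ (norm_nonneg _) (norm_gradient_globalCost_sub_le hn hS x y) 2
  nlinarith

theorem mean_norm_gradient_sq_le (hn : 0 < n) (hS : SmoothCosts ℓ D L) (x : Fin n → Vec d) :
    (n : ℝ)⁻¹ * ∑ i, ‖gradient (globalCost ℓ D) (x i)‖ ^ 2
      ≤ 2 * ‖gradient (globalCost ℓ D) (avg x)‖ ^ 2 + 2 * L ^ 2 * gapX x := by
  have hn' : (n : ℝ) ≠ 0 := by positivity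
  calc (n : ℝ)⁻¹ * ∑ i, ‖gradient (globalCost ℓ D) (x i)‖ ^ 2
      ≤ (n : ℝ)⁻¹ * ∑ i, (2 * ‖gradient (globalCost ℓ D) (avg x)‖ ^ 2
          + 2 * L ^ 2 * ‖x i - avg x‖ ^ 2) := by
        gcongr with i
        exact norm_gradient_globalCost_sq_le hn hS _ _
    _ = _ := by
        simp only [Finset.sum_add_distrib, ← Finset.mul_sum, gapX]
        simp
        field_simp

/-- The heterogeneity bound is used at each user's own model and moved to the average by smoothness,
which is why `B²` also multiplies the gap. -/
theorem mean_norm_stochGrad_sq_le (hn : 0 < n) (hS : SmoothCosts ℓ D L)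
    (hH : BoundedHeterogeneity ℓ D A B) (x z : Fin n → Vec d) :
    (n : ℝ)⁻¹ * ∑ i, ‖gradient (localCost ℓ D i) (x i) + z i‖ ^ 2
      ≤ 2 * A ^ 2 + 4 * B ^ 2 * ‖gradient (globalCost ℓ D) (avg x)‖ ^ 2
        + 4 * B ^ 2 * L ^ 2 * gapX x + 2 * ((n : ℝ)⁻¹ * ∑ i, ‖z i‖ ^ 2) := by
  have hn' : (n : ℝ) ≠ 0 := by positivity
  calc (n : ℝ)⁻¹ * ∑ i, ‖gradient (localCost ℓ D i) (x i) + z i‖ ^ 2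
      ≤ (n : ℝ)⁻¹ * ∑ i, (2 * A ^ 2 + 2 * B ^ 2 * ‖gradient (globalCost ℓ D) (x i)‖ ^ 2
          + 2 * ‖z i‖ ^ 2) := by
        gcongr with i
        have h1 := norm_add_sq_le_two_mul (gradient (localCost ℓ D i) (x i)) (z i)
        have h2 := hH.bound i (x i)
        linarith
    _ = 2 * A ^ 2 + 2 * B ^ 2 * ((n : ℝ)⁻¹ * ∑ i, ‖gradient (globalCost ℓ D) (x i)‖ ^ 2)
          + 2 * ((n : ℝ)⁻¹ * ∑ i, ‖z i‖ ^ 2) := by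
        simp only [Finset.sum_add_distrib, ← Finset.mul_sum]
        simp
        field_simp
    _ ≤ _ := by
        have := mul_le_mul_of_nonneg_left (mean_norm_gradient_sq_le hn hS x)
          (by positivity : 0 ≤ 2 * B ^ 2)
        linarith

/-- One-step decrease of the global cost at the network average. -/
theorem globalCost_avg_mixStep_le (hn : 0 < n) {W : Matrix (Fin n) (Fin n) ℝ}
    (hW : W ∈ doublyStochastic ℝ (Fin n)) (hS : SmoothCosts ℓ D L) {a : ℝ} (ha : 0 ≤ a)
    (haL : 2 * L * a ≤ 1) (x z : Fin n → Vec d) :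
    globalCost ℓ D (avg (mixStep W a x fun i => gradient (localCost ℓ D i) (x i) + z i))
      ≤ globalCost ℓ D (avg x) - a / 2 * ‖gradient (globalCost ℓ D) (avg x)‖ ^ 2
        + a * L ^ 2 / 2 * gapX x + L * a ^ 2 * ‖avg z‖ ^ 2
        - a * inner ℝ (gradient (globalCost ℓ D) (avg x)) (avg z) := by
  set v := gradient (globalCost ℓ D) (avg x)
  let h : Vec d := avg fun i => gradient (localCost ℓ D i) (x i)
  have hdesc := le_quadratic_of_lipschitz_gradient
    (fun y => (hasGradientAt_globalCost hS y).differentiableAt)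
    (norm_gradient_globalCost_sub_le hn hS) (avg x) (-(a • (h + avg z)))
  rw [← sub_eq_add_neg, inner_neg_right, inner_smul_right, inner_add_right, norm_neg, norm_smul,
    mul_pow, Real.norm_of_nonneg ha] at hdesc
  rw [avg_mixStep hW, avg_add]
  -- By polarization, this turns `-a ⟨v, h⟩` into `-a/2 (‖v‖² + ‖h‖²)` plus a multiple of the gap.
  have h1 : ‖v - h‖ ^ 2 ≤ L ^ 2 * gapX x := by
    simp only [v, h]
    rw [gradient_globalCost hS, ← avg_sub]
    refine (norm_avg_sq_le hn _).trans ?_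
    rw [gapX, mul_left_comm, Finset.mul_sum (a := L ^ 2)]
    gcongr with i
    rw [← mul_pow, norm_sub_rev (x i)]
    exact pow_le_pow_left₀ (norm_nonneg _) (hS.lipschitz i _ _) 2
  have h2 := norm_add_sq_le_two_mul h (avg z)
  rw [norm_sub_sq_real] at h1
  have h3 : 0 ≤ a * L := mul_nonneg ha hS.nonneg
  -- Since `2 L a ≤ 1`, the second-order term in `h` is paid for by the `-a/2 ‖h‖²` from
  -- polarization.
  have h4 : L / 2 * (a ^ 2 * ‖h + avg z‖ ^ 2) ≤ a / 2 * ‖h‖ ^ 2 + L * a ^ 2 * ‖avg z‖ ^ 2 := by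
    have h5 : L / 2 * (a ^ 2 * ‖h + avg z‖ ^ 2)
        ≤ L / 2 * (a ^ 2 * (2 * ‖h‖ ^ 2 + 2 * ‖avg z‖ ^ 2)) := by
      have := hS.nonneg
      gcongr
    have h6 : a * ‖h‖ ^ 2 * (2 * L * a) ≤ a * ‖h‖ ^ 2 * 1 := by gcongr
    linarith
  have h7 := mul_le_mul_of_nonneg_left h1 (by positivity : 0 ≤ a / 2)
  linarith

/-- The weight of the noise of the individual users in the one-step analysis. -/
def noiseWeight (n : ℕ) (L lam a : ℝ) : ℝ :=
  24 / 11 * (a ^ 3 * L ^ 2 * lam ^ 2) / (n * (1 - lam) ^ 2)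

/-- The compensated contribution of one iteration's noise `z` to the potential: `v` is the gradient
at the network average, `s2` the average noise variance. -/
def noiseTerm (L a κ s2 : ℝ) (v : Vec d) (z : Fin n → Vec d) : ℝ :=
  (-a * inner ℝ v (avg z) - 3 * a ^ 2 * s2 / n * ‖v‖ ^ 2)
    + (L * a ^ 2 * ‖avg z‖ ^ 2 - 4 * L * a ^ 2 * d * s2 / n)
    + (κ * ∑ i, ‖z i‖ ^ 2 - κ * (n * s2))

/-- The potential: global cost at the network average plus weighted consensus gap. -/
def potential (ℓ : Vec d → Ξ → ℝ) (D : Fin n → Measure Ξ) (L lam a : ℝ) (x : Fin n → Vec d) : ℝ :=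
  globalCost ℓ D (avg x) + 12 / 11 * (a * L ^ 2) / (1 - lam) * gapX x

theorem potential_mixStep_le (hn : 2 ≤ n) {W : Matrix (Fin n) (Fin n) ℝ}
    (hW : W ∈ doublyStochastic ℝ (Fin n)) (hlam : secondSingularValue W < 1)
    (hS : SmoothCosts ℓ D L) (hH : BoundedHeterogeneity ℓ D A B) {a s2 : ℝ} (ha : 0 ≤ a)
    (haL : 2 * L * a ≤ 1) (has : 9 * s2 * a ≤ n)
    (hnet : 48 * (a * secondSingularValue W * L * B) ^ 2 ≤ (1 - secondSingularValue W) ^ 2)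
    (x z : Fin n → Vec d) :
    5 / 132 * a * ((n : ℝ)⁻¹ * ∑ i, ‖gradient (globalCost ℓ D) (x i)‖ ^ 2)
        + potential ℓ D L (secondSingularValue W) a
          (mixStep W a x fun i => gradient (localCost ℓ D i) (x i) + z i)
      ≤ potential ℓ D L (secondSingularValue W) a x
        + noiseWeight n L (secondSingularValue W) a * (n * (A ^ 2 + s2))
        + 4 * L * a ^ 2 * d * s2 / n
        + noiseTerm L a (noiseWeight n L (secondSingularValue W) a) s2
            (gradient (globalCost ℓ D) (avg x)) z := by
  have hn0 : 0 < n := by omega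
  have hn' : (0 : ℝ) < n := by positivity
  have h1 := globalCost_avg_mixStep_le hn0 hW hS ha haL x z
  have h2 := gapX_mixStep_le hn hW hlam ha x fun i => gradient (localCost ℓ D i) (x i) + z i
  have h3 := mean_norm_stochGrad_sq_le hn0 hS hH x z
  have h4 := mean_norm_gradient_sq_le hn0 hS x
  unfold potential noiseTerm noiseWeight
  set lam := secondSingularValue W
  set v := gradient (globalCost ℓ D) (avg x)
  set x' := mixStep W a x fun i => gradient (localCost ℓ D i) (x i) + z i
  set g := (n : ℝ)⁻¹ * ∑ i, ‖gradient (localCost ℓ D i) (x i) + z i‖ ^ 2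
  set Q := (n : ℝ)⁻¹ * ∑ i, ‖gradient (globalCost ℓ D) (x i)‖ ^ 2
  set G := gapX x
  have hG : 0 ≤ G := gapX_nonneg x
  have hl : 0 < 1 - lam := by linarith
  set Z := ∑ i, ‖z i‖ ^ 2
  set N := ‖v‖ ^ 2
  have hN : 0 ≤ N := sq_nonneg _
  have hβ : 0 ≤ 12 / 11 * (a * L ^ 2) / (1 - lam) := by positivity
  have h5 : gapX x' ≤ lam * G + a ^ 2 * lam ^ 2 / (1 - lam) * (2 * A ^ 2 + 4 * B ^ 2 * N
      + 4 * B ^ 2 * L ^ 2 * G + 2 * ((n : ℝ)⁻¹ * Z)) := h2.trans (by gcongr)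
  have h6 := mul_le_mul_of_nonneg_left h5 hβ
  -- the two uses of the network condition
  have hr : (a * lam * L * B) ^ 2 / (1 - lam) ^ 2 ≤ 1 / 48 := by
    rw [div_le_iff₀ (by positivity)]; linarith
  -- The common coefficient of `n A²` and `Z` is `noiseWeight`; the terms with `B` collect into the
  -- ratio bounded in `hr`.
  have h7 : 12 / 11 * (a * L ^ 2) / (1 - lam) * (lam * G + a ^ 2 * lam ^ 2 / (1 - lam)
      * (2 * A ^ 2 + 4 * B ^ 2 * N + 4 * B ^ 2 * L ^ 2 * G + 2 * ((n : ℝ)⁻¹ * Z)))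
      = 12 / 11 * (a * L ^ 2) / (1 - lam) * (lam * G)
        + 24 / 11 * (a ^ 3 * L ^ 2 * lam ^ 2) / (n * (1 - lam) ^ 2) * (n * A ^ 2)
        + 24 / 11 * (a ^ 3 * L ^ 2 * lam ^ 2) / (n * (1 - lam) ^ 2) * Z
        + 48 / 11 * a * N * ((a * lam * L * B) ^ 2 / (1 - lam) ^ 2)
        + 48 / 11 * a * L ^ 2 * G * ((a * lam * L * B) ^ 2 / (1 - lam) ^ 2) := by
    field_simp
    ring
  have h8 : 48 / 11 * a * N * ((a * lam * L * B) ^ 2 / (1 - lam) ^ 2) ≤ 48 / 11 * a * N * (1 / 48) :=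
    mul_le_mul_of_nonneg_left hr (by positivity)
  have h9 : 48 / 11 * a * L ^ 2 * G * ((a * lam * L * B) ^ 2 / (1 - lam) ^ 2)
      ≤ 48 / 11 * a * L ^ 2 * G * (1 / 48) :=
    mul_le_mul_of_nonneg_left hr (by positivity)
  have h10 : 12 / 11 * (a * L ^ 2) / (1 - lam) * (lam * G)
      = 12 / 11 * (a * L ^ 2) / (1 - lam) * G - 12 / 11 * (a * L ^ 2) * G := by
    field_simp; ring
  have h11 : 3 * a ^ 2 * s2 / n * N ≤ a / 3 * N := by
    have : 3 * a ^ 2 * s2 / n ≤ a / 3 := by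
      rw [div_le_iff₀ hn']
      nlinarith
    exact mul_le_mul_of_nonneg_right this hN
  have h12 := mul_le_mul_of_nonneg_left h4 (by positivity : 0 ≤ 5 / 132 * a)
  have h13 : 0 ≤ a * L ^ 2 * G := by positivity
  -- The budget for `a N` is exact: the descent gives `1/2`, spent as `1/3` on the compensator,
  -- `1/11` on heterogeneity and `5/66` on the left-hand side. This fixes `5/132`. For `a L² G`, the
  -- contraction supplies `12/11`, more than `1/2 + 1/11 + 5/66`.
  linarith

end Deterministic

/-! ### Exponential moments of sub-Gaussian noise -/

section MomentGeneratingFunctions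

variable {n d : ℕ} {Ξ : Type*} [MeasurableSpace Ξ]

/-- Jensen for the concave power `u ↦ u ^ s`, done pointwise with the tangent at `u = exp 1`, so
that it works for lower integrals and loses no constant. -/
theorem lintegral_ofReal_exp_mul_le {ν : Measure Ξ} [IsProbabilityMeasure ν] {Y : Ξ → ℝ}
    (hY : Measurable Y)
    (h : ∫⁻ a, ENNReal.ofReal (Real.exp (Y a)) ∂ν ≤ ENNReal.ofReal (Real.exp 1)) {s : ℝ}
    (hs0 : 0 ≤ s) (hs1 : s ≤ 1) :
    ∫⁻ a, ENNReal.ofReal (Real.exp (s * Y a)) ∂ν ≤ ENNReal.ofReal (Real.exp s) := by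
  have hpt : ∀ y : ℝ, Real.exp (s * y)
      ≤ Real.exp s * (1 - s) + Real.exp s * s * Real.exp (-1) * Real.exp y := by
    intro y
    have h1 := convexOn_exp.2 (Set.mem_univ 0) (Set.mem_univ (y - 1)) (sub_nonneg.2 hs1) hs0
      (by ring)
    simp only [smul_eq_mul, mul_zero, zero_add, Real.exp_zero, mul_one] at h1
    have h2 : Real.exp (s * y) = Real.exp s * Real.exp (s * (y - 1)) := by
      rw [← Real.exp_add]; ring_nf
    have h3 : Real.exp (y - 1) = Real.exp (-1) * Real.exp y := by
      rw [← Real.exp_add]; ring_nf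
    rw [h2]
    calc Real.exp s * Real.exp (s * (y - 1))
        ≤ Real.exp s * (1 - s + s * Real.exp (y - 1)) := by gcongr
      _ = _ := by rw [h3]; ring
  have hc : 0 ≤ Real.exp s * (1 - s) := mul_nonneg (Real.exp_pos _).le (sub_nonneg.2 hs1)
  have hc' : 0 ≤ Real.exp s * s * Real.exp (-1) := by positivity
  calc ∫⁻ a, ENNReal.ofReal (Real.exp (s * Y a)) ∂ν
      ≤ ∫⁻ a, (ENNReal.ofReal (Real.exp s * (1 - s))
          + ENNReal.ofReal (Real.exp s * s * Real.exp (-1))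
            * ENNReal.ofReal (Real.exp (Y a))) ∂ν := by
        refine lintegral_mono fun a => ?_
        rw [← ENNReal.ofReal_mul hc', ← ENNReal.ofReal_add hc (by positivity)]
        exact ENNReal.ofReal_le_ofReal (hpt _)
    _ = ENNReal.ofReal (Real.exp s * (1 - s)) + ENNReal.ofReal (Real.exp s * s * Real.exp (-1))
          * ∫⁻ a, ENNReal.ofReal (Real.exp (Y a)) ∂ν := by
        rw [lintegral_add_left measurable_const, lintegral_const_mul _ (by fun_prop)]
        simp
    _ ≤ ENNReal.ofReal (Real.exp s * (1 - s)) + ENNReal.ofReal (Real.exp s * s * Real.exp (-1))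
          * ENNReal.ofReal (Real.exp 1) := by gcongr
    _ = ENNReal.ofReal (Real.exp s) := by
        rw [← ENNReal.ofReal_mul hc', ← ENNReal.ofReal_add hc (by positivity)]
        congr 1
        have : Real.exp (-1) * Real.exp 1 = 1 := by rw [← Real.exp_add]; simp
        linear_combination Real.exp s * s * this

theorem IsSubGaussian.lintegral_exp_sq_le {ν : Measure Ξ} [IsProbabilityMeasure ν] {Z : Ξ → Vec d}
    {s : ℝ} (hZ : Measurable Z) (h : IsSubGaussian ν Z s) {κ : ℝ} (hκ : 0 ≤ κ)
    (hκs : κ * s ^ 2 ≤ 1) :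
    ∫⁻ a, ENNReal.ofReal (Real.exp (κ * ‖Z a‖ ^ 2)) ∂ν ≤ ENNReal.ofReal (Real.exp (κ * s ^ 2)) := by
  unfold IsSubGaussian at h
  split_ifs at h with hs
  · have : ∫⁻ a, ENNReal.ofReal (Real.exp (κ * ‖Z a‖ ^ 2)) ∂ν = ∫⁻ _, 1 ∂ν := by
      refine lintegral_congr_ae ?_
      filter_upwards [h] with a ha
      simp [ha]
    rw [this]
    simp [hs]
  · have h1 := lintegral_ofReal_exp_mul_le (ν := ν) (by fun_prop) h (by positivity) hκs
    have h2 : ∀ a, κ * s ^ 2 * (‖Z a‖ ^ 2 / s ^ 2) = κ * ‖Z a‖ ^ 2 := fun a => by field_simp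
    simpa only [h2] using h1

/-- For centred noise the linear term integrates to zero, leaving only the exponential of the
square. -/
theorem exp_le_add_exp_sq (x : ℝ) : Real.exp x ≤ x + Real.exp (x ^ 2) := by
  have hsq := Real.add_one_le_exp (x ^ 2)
  rcases le_total |x| 1 with h | h
  · have := (abs_le.1 (Real.abs_exp_sub_one_sub_id_le h)).2
    linarith
  rcases le_total 0 x with h0 | h0
  · rw [abs_of_nonneg h0] at h
    have : Real.exp x ≤ Real.exp (x ^ 2) := Real.exp_le_exp.2 (by nlinarith)
    linarith
  · rw [abs_of_nonpos h0] at h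
    have : Real.exp x ≤ 1 := Real.exp_le_one_iff.2 h0
    nlinarith

/-- Two regimes. For `‖u‖ s ≤ 1`, the bound `exp x ≤ x + exp (x²)` and the zero mean suffice. For
`‖u‖ s > 1`, Young's inequality gives `exp (‖u‖² s² / 2 + 1/2)`, and the `1/2` is below `‖u‖² s² /
2`. -/
theorem IsSubGaussian.lintegral_exp_inner_le {ν : Measure Ξ} [IsProbabilityMeasure ν]
    {Z : Ξ → Vec d} {s : ℝ} (hs0 : 0 ≤ s) (hZ : Measurable Z) (hint : Integrable Z ν)
    (hmean : ∫ a, Z a ∂ν = 0) (h : IsSubGaussian ν Z s) (u : Vec d) :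
    ∫⁻ a, ENNReal.ofReal (Real.exp (inner ℝ u (Z a))) ∂ν
      ≤ ENNReal.ofReal (Real.exp (‖u‖ ^ 2 * s ^ 2)) := by
  by_cases hus : ‖u‖ ^ 2 * s ^ 2 ≤ 1
  · have h1 := h.lintegral_exp_sq_le hZ (sq_nonneg ‖u‖) hus
    have hmeas : Measurable fun a => Real.exp (‖u‖ ^ 2 * ‖Z a‖ ^ 2) := by fun_prop
    have hexp : Integrable (fun a => Real.exp (‖u‖ ^ 2 * ‖Z a‖ ^ 2)) ν := by
      refine (lintegral_ofReal_ne_top_iff_integrable hmeas.aestronglyMeasurable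
        (Filter.Eventually.of_forall fun _ => (Real.exp_pos _).le)).1 ?_
      exact (h1.trans_lt ENNReal.ofReal_lt_top).ne
    have hin : Integrable (fun a => inner ℝ u (Z a)) ν := hint.const_inner u
    have hpt : ∀ a, Real.exp (inner ℝ u (Z a))
        ≤ inner ℝ u (Z a) + Real.exp (‖u‖ ^ 2 * ‖Z a‖ ^ 2) := by
      intro a
      refine (exp_le_add_exp_sq _).trans ?_
      gcongr
      rw [← mul_pow, ← sq_abs]
      gcongr
      exact abs_real_inner_le_norm _ _
    calc ∫⁻ a, ENNReal.ofReal (Real.exp (inner ℝ u (Z a))) ∂ν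
        ≤ ∫⁻ a, ENNReal.ofReal (inner ℝ u (Z a) + Real.exp (‖u‖ ^ 2 * ‖Z a‖ ^ 2)) ∂ν :=
          lintegral_mono fun a => ENNReal.ofReal_le_ofReal (hpt a)
      _ = ENNReal.ofReal (∫ a, (inner ℝ u (Z a) + Real.exp (‖u‖ ^ 2 * ‖Z a‖ ^ 2)) ∂ν) :=
          (ofReal_integral_eq_lintegral_ofReal (hin.add hexp)
            (Filter.Eventually.of_forall fun a => (Real.exp_pos _).le.trans (hpt a))).symm
      _ = ENNReal.ofReal (∫ a, Real.exp (‖u‖ ^ 2 * ‖Z a‖ ^ 2) ∂ν) := by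
          rw [integral_add hin hexp, integral_inner hint, hmean, inner_zero_right, zero_add]
      _ = ∫⁻ a, ENNReal.ofReal (Real.exp (‖u‖ ^ 2 * ‖Z a‖ ^ 2)) ∂ν :=
          ofReal_integral_eq_lintegral_ofReal hexp
            (Filter.Eventually.of_forall fun _ => (Real.exp_pos _).le)
      _ ≤ _ := h1
  · have hs : 0 < s := by
      rcases hs0.eq_or_lt with h0 | h0
      · rw [← h0] at hus; simp at hus
      · exact h0
    push Not at hus
    have h1 := h.lintegral_exp_sq_le hZ (κ := 1 / (2 * s ^ 2)) (by positivity)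
      (by field_simp; norm_num)
    have hpt : ∀ a, Real.exp (inner ℝ u (Z a))
        ≤ Real.exp (‖u‖ ^ 2 * s ^ 2 / 2) * Real.exp (1 / (2 * s ^ 2) * ‖Z a‖ ^ 2) := by
      intro a
      rw [← Real.exp_add]
      refine Real.exp_le_exp.2 ((real_inner_le_norm _ _).trans ?_)
      have h2 : ‖u‖ ^ 2 * s ^ 2 / 2 + 1 / (2 * s ^ 2) * ‖Z a‖ ^ 2 - ‖u‖ * ‖Z a‖
          = (‖u‖ * s - ‖Z a‖ / s) ^ 2 / 2 := by field_simp; ring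
      have h3 : 0 ≤ (‖u‖ * s - ‖Z a‖ / s) ^ 2 / 2 := by positivity
      linarith
    calc ∫⁻ a, ENNReal.ofReal (Real.exp (inner ℝ u (Z a))) ∂ν
        ≤ ∫⁻ a, ENNReal.ofReal (Real.exp (‖u‖ ^ 2 * s ^ 2 / 2))
            * ENNReal.ofReal (Real.exp (1 / (2 * s ^ 2) * ‖Z a‖ ^ 2)) ∂ν := by
          refine lintegral_mono fun a => ?_
          rw [← ENNReal.ofReal_mul (Real.exp_pos _).le]
          exact ENNReal.ofReal_le_ofReal (hpt a)
      _ = ENNReal.ofReal (Real.exp (‖u‖ ^ 2 * s ^ 2 / 2))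
            * ∫⁻ a, ENNReal.ofReal (Real.exp (1 / (2 * s ^ 2) * ‖Z a‖ ^ 2)) ∂ν :=
          lintegral_const_mul _ (by fun_prop)
      _ ≤ ENNReal.ofReal (Real.exp (‖u‖ ^ 2 * s ^ 2 / 2))
            * ENNReal.ofReal (Real.exp (1 / (2 * s ^ 2) * s ^ 2)) := by gcongr
      _ ≤ ENNReal.ofReal (Real.exp (‖u‖ ^ 2 * s ^ 2)) := by
          rw [← ENNReal.ofReal_mul (Real.exp_pos _).le, ← Real.exp_add]
          refine ENNReal.ofReal_le_ofReal (Real.exp_le_exp.2 ?_)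
          have : 1 / (2 * s ^ 2) * s ^ 2 = 1 / 2 := by field_simp
          linarith

/-- The integral equals `(1 - 2c)^(-1/2)`; the estimate reduces to `(1 + 4c)(1 - 2c) ≥ 1`, which is
where `c ≤ 1/4` comes from. -/
theorem lintegral_exp_sq_gaussianReal_le {c : ℝ} (hc0 : 0 ≤ c) (hc : c ≤ 1 / 4) :
    ∫⁻ x, ENNReal.ofReal (Real.exp (c * x ^ 2)) ∂(gaussianReal 0 1)
      ≤ ENNReal.ofReal (Real.exp (2 * c)) := by
  have hb : 0 < 1 / 2 - c := by linarith
  have hpt : ∀ x : ℝ, gaussianPDFReal 0 1 x * Real.exp (c * x ^ 2)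
      = (√(2 * Real.pi))⁻¹ * Real.exp (-(1 / 2 - c) * x ^ 2) := by
    intro x
    simp only [gaussianPDFReal, NNReal.coe_one, mul_one, sub_zero]
    rw [mul_assoc, ← Real.exp_add]
    ring_nf
  rw [gaussianReal_of_var_ne_zero 0 one_ne_zero,
    lintegral_withDensity_eq_lintegral_mul _ (measurable_gaussianPDF 0 1) (by fun_prop)]
  calc ∫⁻ x, (gaussianPDF 0 1 * fun x => ENNReal.ofReal (Real.exp (c * x ^ 2))) x
      = ∫⁻ x, ENNReal.ofReal ((√(2 * Real.pi))⁻¹ * Real.exp (-(1 / 2 - c) * x ^ 2)) := by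
        refine lintegral_congr fun x => ?_
        rw [← hpt, ENNReal.ofReal_mul (gaussianPDFReal_nonneg _ _ _)]
        rfl
    _ = ENNReal.ofReal ((√(2 * Real.pi))⁻¹ * √(Real.pi / (1 / 2 - c))) := by
        rw [← integral_gaussian, ← integral_const_mul, ofReal_integral_eq_lintegral_ofReal
          ((integrable_exp_neg_mul_sq hb).const_mul _)
          (Filter.Eventually.of_forall fun x => by positivity)]
    _ ≤ ENNReal.ofReal (Real.exp (2 * c)) := by
        refine ENNReal.ofReal_le_ofReal ?_
        rw [inv_mul_le_iff₀ (by positivity)]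
        refine Real.sqrt_le_iff.2 ⟨by positivity, ?_⟩
        rw [mul_pow, Real.sq_sqrt (by positivity), ← Real.exp_nat_mul, div_le_iff₀ hb]
        have h1 := Real.add_one_le_exp (((2 : ℕ) : ℝ) * (2 * c))
        have h2 : (1 : ℝ) ≤ 2 * Real.exp (((2 : ℕ) : ℝ) * (2 * c)) * (1 / 2 - c) := by
          push_cast at h1 ⊢
          nlinarith
        have := Real.pi_pos
        nlinarith

/-- A real random variable with sub-Gaussian moment generating function has a sub-exponential
square. -/
theorem lintegral_exp_sq_le_of_subGaussian {ν : Measure Ξ} [IsProbabilityMeasure ν] {Y : Ξ → ℝ}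
    (hY : Measurable Y) {v : ℝ} (hv : 0 ≤ v)
    (h : ∀ t, ∫⁻ a, ENNReal.ofReal (Real.exp (t * Y a)) ∂ν
      ≤ ENNReal.ofReal (Real.exp (t ^ 2 * v))) {s : ℝ} (hs : 0 ≤ s) (hsv : 4 * s * v ≤ 1 / 2) :
    ∫⁻ a, ENNReal.ofReal (Real.exp (s * Y a ^ 2)) ∂ν ≤ ENNReal.ofReal (Real.exp (4 * s * v)) := by
  -- Gaussian linearization: the exponential of a square is a Gaussian average of exponentials of
  -- linear functions, to which `h` applies after exchanging the integrals.
  have hgauss : ∀ y : ℝ, ENNReal.ofReal (Real.exp (s * y ^ 2))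
      = ∫⁻ g, ENNReal.ofReal (Real.exp (√(2 * s) * g * y)) ∂(gaussianReal 0 1) := by
    intro y
    have h1 := congrFun (mgf_id_gaussianReal (μ := 0) (v := 1)) (√(2 * s) * y)
    have h2 : (0 : ℝ) * (√(2 * s) * y) + ((1 : NNReal) : ℝ) * (√(2 * s) * y) ^ 2 / 2
        = s * y ^ 2 := by
      rw [mul_pow, Real.sq_sqrt (by positivity)]; simp; ring
    rw [h2] at h1
    simp only [mgf, id] at h1
    rw [← h1, ofReal_integral_eq_lintegral_ofReal (integrable_exp_mul_gaussianReal _)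
      (Filter.Eventually.of_forall fun _ => (Real.exp_pos _).le)]
    refine lintegral_congr fun g => ?_
    ring_nf
  simp_rw [hgauss]
  rw [lintegral_lintegral_swap (by fun_prop)]
  calc ∫⁻ g, ∫⁻ a, ENNReal.ofReal (Real.exp (√(2 * s) * g * Y a)) ∂ν ∂(gaussianReal 0 1)
      ≤ ∫⁻ g, ENNReal.ofReal (Real.exp (2 * s * v * g ^ 2)) ∂(gaussianReal 0 1) := by
        refine lintegral_mono fun g => (h _).trans_eq ?_
        rw [mul_pow, Real.sq_sqrt (by positivity)]
        ring_nf
    _ ≤ ENNReal.ofReal (Real.exp (2 * (2 * s * v))) :=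
        lintegral_exp_sq_gaussianReal_le (by positivity) (by linarith)
    _ = _ := by ring_nf

theorem lintegral_pi_prod {ν : Fin n → Measure Ξ} [∀ i, IsProbabilityMeasure (ν i)]
    {g : Fin n → Ξ → ENNReal} (hg : ∀ i, Measurable (g i)) :
    ∫⁻ s, ∏ i, g i (s i) ∂(Measure.pi ν) = ∏ i, ∫⁻ a, g i a ∂(ν i) := by
  rw [lintegral_prod_eq_prod_lintegral_of_indepFun Finset.univ
    (fun i (s : Fin n → Ξ) => g i (s i)) (iIndepFun_pi fun i => (hg i).aemeasurable)
    fun i => (hg i).comp (measurable_pi_apply i)]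
  refine Finset.prod_congr rfl fun i _ => ?_
  exact (measurePreserving_eval ν i).lintegral_comp (hg i)

theorem lintegral_pi_exp_sum_le {ν : Fin n → Measure Ξ} [∀ i, IsProbabilityMeasure (ν i)]
    {Y : Fin n → Ξ → ℝ} (hY : ∀ i, Measurable (Y i)) {b : Fin n → ℝ}
    (h : ∀ i, ∫⁻ a, ENNReal.ofReal (Real.exp (Y i a)) ∂(ν i) ≤ ENNReal.ofReal (Real.exp (b i))) :
    ∫⁻ s, ENNReal.ofReal (Real.exp (∑ i, Y i (s i))) ∂(Measure.pi ν)
      ≤ ENNReal.ofReal (Real.exp (∑ i, b i)) := by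
  simp_rw [Real.exp_sum, ENNReal.ofReal_prod_of_nonneg fun i _ => (Real.exp_pos _).le]
  rw [lintegral_pi_prod (g := fun i a => ENNReal.ofReal (Real.exp (Y i a))) fun i => by
    have := hY i
    fun_prop]
  exact Finset.prod_le_prod' fun i _ => h i

/-! ### Compensated noise of one iteration -/

section Noise

variable {ν : Fin n → Measure Ξ} [∀ i, IsProbabilityMeasure (ν i)] {Z : Fin n → Ξ → Vec d}
  {σ : Fin n → ℝ}

theorem measurable_avg : Measurable (avg : (Fin n → Vec d) → Vec d) := by
  unfold avg; fun_prop

/-- The source of the speed-up in `n`: for independent users the variances add, while averaging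
scales each by `n⁻²`. -/
theorem lintegral_pi_exp_inner_avg_le (hn : 0 < n) (hZ : ∀ i, Measurable (Z i))
    (h : ∀ i u, ∫⁻ a, ENNReal.ofReal (Real.exp (inner ℝ u (Z i a))) ∂(ν i)
      ≤ ENNReal.ofReal (Real.exp (‖u‖ ^ 2 * σ i ^ 2))) (u : Vec d) :
    ∫⁻ s, ENNReal.ofReal (Real.exp (inner ℝ u (avg fun i => Z i (s i)))) ∂(Measure.pi ν)
      ≤ ENNReal.ofReal (Real.exp (‖u‖ ^ 2 * (((n : ℝ)⁻¹ * ∑ i, σ i ^ 2) / n))) := by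
  have h1 := lintegral_pi_exp_sum_le (ν := ν) (Y := fun i a => inner ℝ ((n : ℝ)⁻¹ • u) (Z i a))
    (b := fun i => ‖(n : ℝ)⁻¹ • u‖ ^ 2 * σ i ^ 2) (fun i => by
      have := hZ i
      fun_prop) fun i => h i _
  have h2 : ∀ s : Fin n → Ξ, ∑ i, inner ℝ ((n : ℝ)⁻¹ • u) (Z i (s i))
      = inner ℝ u (avg fun i => Z i (s i)) := by
    intro s
    rw [avg, inner_smul_right, inner_sum, Finset.mul_sum]
    simp [inner_smul_left]
  have h3 : ∑ i, ‖(n : ℝ)⁻¹ • u‖ ^ 2 * σ i ^ 2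
      = ‖u‖ ^ 2 * (((n : ℝ)⁻¹ * ∑ i, σ i ^ 2) / n) := by
    rw [← Finset.mul_sum, norm_smul, mul_pow, Real.norm_of_nonneg (by positivity)]
    ring
  simp only [h2] at h1
  rwa [h3] at h1

/-- Jensen, with `‖w‖²` written as the mean of the numbers `d · w k ^ 2`. It reduces to scalar
coordinates without any independence among them, at the price of a factor `d`. -/
theorem exp_mul_norm_sq_le (hd : 0 < d) (θ : ℝ) (w : Vec d) :
    Real.exp (θ * ‖w‖ ^ 2) ≤ ∑ k, (d : ℝ)⁻¹ * Real.exp (θ * d * w k ^ 2) := by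
  have hd' : (d : ℝ) ≠ 0 := by positivity
  have h := convexOn_exp.map_sum_le (t := Finset.univ) (w := fun _ : Fin d => (d : ℝ)⁻¹)
    (p := fun k => θ * d * w k ^ 2) (fun _ _ => by positivity) (by simp [hd'])
    (fun _ _ => Set.mem_univ _)
  simp only [smul_eq_mul] at h
  have h2 : ∑ k, (d : ℝ)⁻¹ * (θ * d * w k ^ 2) = θ * ‖w‖ ^ 2 := by
    rw [EuclideanSpace.real_norm_sq_eq, Finset.mul_sum]
    refine Finset.sum_congr rfl fun k _ => ?_
    field_simp
  rwa [h2] at h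

/-- Each coordinate of the averaged noise is a scalar sub-Gaussian variable with parameter `σ² / n`.
Going through linear functionals retains the `1 / n` that bounding `‖avg z‖²` by the mean of `‖zᵢ‖²`
would lose. -/
theorem lintegral_pi_exp_norm_avg_sq_le (hn : 0 < n) (hd : 0 < d) (hZ : ∀ i, Measurable (Z i))
    (h : ∀ i u, ∫⁻ a, ENNReal.ofReal (Real.exp (inner ℝ u (Z i a))) ∂(ν i)
      ≤ ENNReal.ofReal (Real.exp (‖u‖ ^ 2 * σ i ^ 2))) {θ : ℝ} (hθ : 0 ≤ θ)
    (hθs : 4 * (θ * d) * (((n : ℝ)⁻¹ * ∑ i, σ i ^ 2) / n) ≤ 1 / 2) :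
    ∫⁻ s, ENNReal.ofReal (Real.exp (θ * ‖avg fun i => Z i (s i)‖ ^ 2)) ∂(Measure.pi ν)
      ≤ ENNReal.ofReal (Real.exp (4 * (θ * d) * (((n : ℝ)⁻¹ * ∑ i, σ i ^ 2) / n))) := by
  set v := ((n : ℝ)⁻¹ * ∑ i, σ i ^ 2) / n
  have hv : 0 ≤ v := by positivity
  have hmeas : Measurable fun s : Fin n → Ξ => avg fun i => Z i (s i) :=
    measurable_avg.comp (measurable_pi_lambda _ fun i => (hZ i).comp (measurable_pi_apply i))
  have hcoord : ∀ k : Fin d, Measurable fun s : Fin n → Ξ => (avg fun i => Z i (s i)) k :=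
    fun k => by fun_prop
  have hk : ∀ k : Fin d, ∫⁻ s, ENNReal.ofReal
      (Real.exp (θ * d * (avg fun i => Z i (s i)) k ^ 2)) ∂(Measure.pi ν)
        ≤ ENNReal.ofReal (Real.exp (4 * (θ * d) * v)) := by
    intro k
    refine lintegral_exp_sq_le_of_subGaussian (hcoord k) hv (fun t => ?_) (by positivity) hθs
    have h1 := lintegral_pi_exp_inner_avg_le hn hZ h (EuclideanSpace.single k t)
    simpa [EuclideanSpace.inner_single_left, mul_comm] using h1
  calc ∫⁻ s, ENNReal.ofReal (Real.exp (θ * ‖avg fun i => Z i (s i)‖ ^ 2)) ∂(Measure.pi ν)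
      ≤ ∫⁻ s, ∑ k : Fin d, ENNReal.ofReal (d : ℝ)⁻¹ * ENNReal.ofReal
          (Real.exp (θ * d * (avg fun i => Z i (s i)) k ^ 2)) ∂(Measure.pi ν) := by
        refine lintegral_mono fun s => ?_
        refine (ENNReal.ofReal_le_ofReal (exp_mul_norm_sq_le hd θ _)).trans_eq ?_
        rw [ENNReal.ofReal_sum_of_nonneg fun k _ => by positivity]
        exact Finset.sum_congr rfl fun k _ => ENNReal.ofReal_mul (by positivity)
    _ = ∑ k : Fin d, ENNReal.ofReal (d : ℝ)⁻¹ * ∫⁻ s, ENNReal.ofReal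
          (Real.exp (θ * d * (avg fun i => Z i (s i)) k ^ 2)) ∂(Measure.pi ν) := by
        rw [lintegral_finsetSum _ fun k _ => by have := hcoord k; fun_prop]
        exact Finset.sum_congr rfl fun k _ =>
          lintegral_const_mul _ (by have := hcoord k; fun_prop)
    _ ≤ ∑ _k : Fin d, ENNReal.ofReal (d : ℝ)⁻¹ * ENNReal.ofReal (Real.exp (4 * (θ * d) * v)) := by
        gcongr with k
        exact hk k
    _ = ENNReal.ofReal (Real.exp (4 * (θ * d) * v)) := by
        rw [← Finset.sum_mul, Finset.sum_const, Finset.card_univ, Fintype.card_fin, nsmul_eq_mul,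
          ← ENNReal.ofReal_natCast, ← ENNReal.ofReal_mul (by positivity),
          mul_inv_cancel₀ (by positivity), ENNReal.ofReal_one, one_mul]

theorem lintegral_exp_sub_le_one {P : Measure Ξ} {Y : Ξ → ℝ} (hY : Measurable Y) {b : ℝ}
    (h : ∫⁻ a, ENNReal.ofReal (Real.exp (Y a)) ∂P ≤ ENNReal.ofReal (Real.exp b)) :
    ∫⁻ a, ENNReal.ofReal (Real.exp (Y a - b)) ∂P ≤ 1 := by
  simp_rw [sub_eq_add_neg, Real.exp_add, ENNReal.ofReal_mul (Real.exp_pos _).le]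
  rw [lintegral_mul_const _ (by fun_prop)]
  calc _ ≤ ENNReal.ofReal (Real.exp b) * ENNReal.ofReal (Real.exp (-b)) := by gcongr
    _ = 1 := by rw [← ENNReal.ofReal_mul (Real.exp_pos _).le, ← Real.exp_add]; simp

/-- The three noise terms depend on the same samples, so independence cannot separate them.
Convexity of `exp` does, at the cost of tripling each exponent. -/
theorem lintegral_exp_add_add_le_one {P : Measure Ξ} {X Y V : Ξ → ℝ} (hX : Measurable X)
    (hY : Measurable Y)
    (h1 : ∫⁻ a, ENNReal.ofReal (Real.exp (3 * X a)) ∂P ≤ 1)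
    (h2 : ∫⁻ a, ENNReal.ofReal (Real.exp (3 * Y a)) ∂P ≤ 1)
    (h3 : ∫⁻ a, ENNReal.ofReal (Real.exp (3 * V a)) ∂P ≤ 1) :
    ∫⁻ a, ENNReal.ofReal (Real.exp (X a + Y a + V a)) ∂P ≤ 1 := by
  have hpt : ∀ x y z : ℝ, Real.exp (x + y + z)
      ≤ (1 / 3) * (Real.exp (3 * x) + Real.exp (3 * y) + Real.exp (3 * z)) := by
    intro x y z
    have h := convexOn_exp.map_sum_le (t := Finset.univ) (w := fun _ : Fin 3 => (1 / 3 : ℝ))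
      (p := ![3 * x, 3 * y, 3 * z]) (fun _ _ => by norm_num) (by norm_num [Fin.sum_univ_three])
      (fun _ _ => Set.mem_univ _)
    simp only [smul_eq_mul, Fin.sum_univ_three, Matrix.cons_val] at h
    calc Real.exp (x + y + z) = Real.exp (1 / 3 * (3 * x) + 1 / 3 * (3 * y) + 1 / 3 * (3 * z)) := by
          ring_nf
      _ ≤ _ := h
      _ = _ := by ring
  have hr : ENNReal.ofReal (1 / 3) * 3 = 1 := by
    rw [show (3 : ENNReal) = ENNReal.ofReal 3 by simp, ← ENNReal.ofReal_mul (by norm_num)]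
    norm_num
  calc ∫⁻ a, ENNReal.ofReal (Real.exp (X a + Y a + V a)) ∂P
      ≤ ∫⁻ a, ENNReal.ofReal (1 / 3) * (ENNReal.ofReal (Real.exp (3 * X a))
          + ENNReal.ofReal (Real.exp (3 * Y a)) + ENNReal.ofReal (Real.exp (3 * V a))) ∂P := by
        refine lintegral_mono fun a => ?_
        rw [← ENNReal.ofReal_add (Real.exp_pos _).le (Real.exp_pos _).le,
          ← ENNReal.ofReal_add (by positivity) (Real.exp_pos _).le,
          ← ENNReal.ofReal_mul (by norm_num)]
        exact ENNReal.ofReal_le_ofReal (hpt _ _ _)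
    _ = ENNReal.ofReal (1 / 3) * (∫⁻ a, ENNReal.ofReal (Real.exp (3 * X a)) ∂P
          + ∫⁻ a, ENNReal.ofReal (Real.exp (3 * Y a)) ∂P
          + ∫⁻ a, ENNReal.ofReal (Real.exp (3 * V a)) ∂P) := by
        rw [lintegral_const_mul' _ _ ENNReal.ofReal_ne_top, lintegral_add_left (by fun_prop),
          lintegral_add_left (by fun_prop)]
    _ ≤ ENNReal.ofReal (1 / 3) * (1 + 1 + 1) := by gcongr
    _ = 1 := by rw [show (1 + 1 + 1 : ENNReal) = 3 by norm_num, hr]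

/-- The compensated noise of one iteration has exponential moment at most one. -/
theorem lintegral_pi_exp_noiseTerm_le_one (hn : 0 < n) (hd : 0 < d) (hσ : ∀ i, 0 ≤ σ i)
    (hZ : ∀ i, Measurable (Z i)) (hint : ∀ i, Integrable (Z i) (ν i))
    (hmean : ∀ i, ∫ a, Z i a ∂(ν i) = 0) (hsub : ∀ i, IsSubGaussian (ν i) (Z i) (σ i))
    {L a κ s2 : ℝ} (hL : 0 ≤ L) (hκ : 0 ≤ κ) (hs2 : s2 = (n : ℝ)⁻¹ * ∑ i, σ i ^ 2)
    (hdim : 360 * L * a ^ 2 * d * s2 ≤ n) (hκσ : ∀ i, 3 * κ * σ i ^ 2 ≤ 1) (v : Vec d) :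
    ∫⁻ s, ENNReal.ofReal (Real.exp (noiseTerm L a κ s2 v fun i => Z i (s i))) ∂(Measure.pi ν)
      ≤ 1 := by
  have hn' : (0 : ℝ) < n := by positivity
  have hmgf : ∀ i u, ∫⁻ a, ENNReal.ofReal (Real.exp (inner ℝ u (Z i a))) ∂(ν i)
      ≤ ENNReal.ofReal (Real.exp (‖u‖ ^ 2 * σ i ^ 2)) := fun i u =>
    (hsub i).lintegral_exp_inner_le (hσ i) (hZ i) (hint i) (hmean i) u
  have hz : Measurable fun (s : Fin n → Ξ) i => Z i (s i) :=
    measurable_pi_lambda _ fun i => (hZ i).comp (measurable_pi_apply i)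
  have hmeas : Measurable fun s : Fin n → Ξ => avg fun i => Z i (s i) := measurable_avg.comp hz
  have hzi : ∀ i, Measurable fun s : Fin n → Ξ => Z i (s i) :=
    fun i => (hZ i).comp (measurable_pi_apply i)
  unfold noiseTerm
  refine lintegral_exp_add_add_le_one (by fun_prop) (by fun_prop) ?_ ?_ ?_
  -- The tripled direction gives `9 a² ‖v‖² s2 / n`, three times the compensator in `noiseTerm`.
  · have h1 := lintegral_pi_exp_inner_avg_le hn hZ hmgf ((-3 * a) • v)
    rw [← hs2] at h1
    have h2 := lintegral_exp_sub_le_one (by fun_prop) h1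
    convert h2 using 6 with s
    rw [inner_smul_left, norm_smul, mul_pow, Real.norm_eq_abs, sq_abs]
    simp; ring
  -- Only `24 L a² d s2 ≤ n` is needed here; the constant `360` leaves room.
  · have hθ : 4 * (3 * (L * a ^ 2) * d) * (s2 / n) ≤ 1 / 2 := by
      rw [← mul_div_assoc, div_le_iff₀ hn']
      have : 0 ≤ L * a ^ 2 * d * s2 := by rw [hs2]; positivity
      nlinarith
    have h1 := lintegral_pi_exp_norm_avg_sq_le hn hd hZ hmgf (θ := 3 * (L * a ^ 2))
      (by positivity) (by rwa [← hs2])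
    rw [← hs2] at h1
    have h2 := lintegral_exp_sub_le_one (by fun_prop) h1
    convert h2 using 6 with s
    ring
  · have h1 := lintegral_pi_exp_sum_le (ν := ν) (Y := fun i a => 3 * κ * ‖Z i a‖ ^ 2)
      (b := fun i => 3 * κ * σ i ^ 2) (fun i => by have := hZ i; fun_prop)
      fun i => (hsub i).lintegral_exp_sq_le (hZ i) (by positivity) (hκσ i)
    have h2 := lintegral_exp_sub_le_one (by fun_prop) h1
    convert h2 using 6 with s
    rw [← Finset.mul_sum, ← Finset.mul_sum, hs2, mul_inv_cancel_left₀ hn'.ne']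
    ring

end Noise

end MomentGeneratingFunctions

/-! ### Independence across iterations and the exponential supermartingale -/

section Iterates

variable {n d : ℕ} {Ξ Ω : Type*} [MeasurableSpace Ξ]

/-- Adding an increment driven by an independent variable does not increase the exponential moment,
if the increment has exponential moment at most one at every state. -/
theorem lintegral_exp_add_le_of_indepFun [MeasurableSpace Ω] {μ : Measure Ω}
    [IsProbabilityMeasure μ] {E F : Type*} [MeasurableSpace E] [MeasurableSpace F] {S : Ω → ℝ}
    {X : Ω → E} {V : Ω → F} (hS : Measurable S) (hX : Measurable X) (hV : Measurable V)
    (hind : IndepFun (fun ω => (S ω, X ω)) V μ) {Φ : E → F → ℝ}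
    (hΦ : Measurable (Function.uncurry Φ))
    (h : ∀ x, ∫⁻ v, ENNReal.ofReal (Real.exp (Φ x v)) ∂(μ.map V) ≤ 1) :
    ∫⁻ ω, ENNReal.ofReal (Real.exp (S ω + Φ (X ω) (V ω))) ∂μ
      ≤ ∫⁻ ω, ENNReal.ofReal (Real.exp (S ω)) ∂μ := by
  have hSX : Measurable fun ω => (S ω, X ω) := hS.prodMk hX
  have hmap := (indepFun_iff_map_prod_eq_prod_map_map hSX.aemeasurable hV.aemeasurable).1 hind
  have : IsProbabilityMeasure (μ.map V) := Measure.isProbabilityMeasure_map hV.aemeasurable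
  have hΦ' : Measurable fun q : (ℝ × E) × F => Φ q.1.2 q.2 :=
    hΦ.comp ((measurable_snd.comp measurable_fst).prodMk measurable_snd)
  calc ∫⁻ ω, ENNReal.ofReal (Real.exp (S ω + Φ (X ω) (V ω))) ∂μ
      = ∫⁻ q : (ℝ × E) × F, ENNReal.ofReal (Real.exp (q.1.1 + Φ q.1.2 q.2))
          ∂(μ.map fun ω => ((S ω, X ω), V ω)) := by
        rw [lintegral_map (by fun_prop) (hSX.prodMk hV)]
    _ = ∫⁻ u : ℝ × E, ∫⁻ v, ENNReal.ofReal (Real.exp (u.1 + Φ u.2 v)) ∂(μ.map V)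
          ∂(μ.map fun ω => (S ω, X ω)) := by
        rw [hmap, lintegral_prod _ (by fun_prop)]
    _ ≤ ∫⁻ u : ℝ × E, ENNReal.ofReal (Real.exp u.1) ∂(μ.map fun ω => (S ω, X ω)) := by
        refine lintegral_mono fun u => ?_
        simp_rw [Real.exp_add, ENNReal.ofReal_mul (Real.exp_pos _).le]
        rw [lintegral_const_mul' _ _ ENNReal.ofReal_ne_top]
        exact mul_le_of_le_one_right' (h u.2)
    _ = ∫⁻ ω, ENNReal.ofReal (Real.exp (S ω)) ∂μ := by
        rw [lintegral_map (by fun_prop) hSX]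

theorem measurable_apply_of_uncurry [MeasurableSpace Ω] {E F' G : Type*} [MeasurableSpace E]
    [MeasurableSpace F'] [MeasurableSpace G] {F : E → F' → G}
    (hF : Measurable (Function.uncurry F)) {f : Ω → E} {g : Ω → F'} (hf : Measurable f)
    (hg : Measurable g) : Measurable fun ω => F (f ω) (g ω) :=
  hF.comp (hf.prodMk hg)

/-- The information of the samples drawn before iteration `t`. -/
@[reducible] def past (ξ : Fin n → ℕ → Ω → Ξ) (t : ℕ) : MeasurableSpace Ω :=
  ⨆ p ∈ {p : Fin n × ℕ | p.2 < t}, MeasurableSpace.comap (ξ p.1 p.2) inferInstance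

theorem past_mono (ξ : Fin n → ℕ → Ω → Ξ) {s t : ℕ} (h : s ≤ t) : past ξ s ≤ past ξ t :=
  biSup_mono fun _ hp => lt_of_lt_of_le hp h

theorem measurable_past (ξ : Fin n → ℕ → Ω → Ξ) (i : Fin n) (t : ℕ) :
    Measurable[past ξ (t + 1)] (ξ i t) := by
  refine Measurable.of_comap_le ?_
  exact le_biSup (fun p : Fin n × ℕ => MeasurableSpace.comap (ξ p.1 p.2) inferInstance)
    (show (i, t) ∈ {p : Fin n × ℕ | p.2 < t + 1} from Nat.lt_succ_self t)

variable {ℓ : Vec d → Ξ → ℝ} {D : Fin n → Measure Ξ} {L : ℝ}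

/-- With time counted from zero, iterate `t` uses only samples with index strictly below `t`, hence
none of those it is about to be combined with. -/
theorem IsOracle.measurable_iter (hO : IsOracle ℓ D) (W : Matrix (Fin n) (Fin n) ℝ) (α : ℕ → ℝ)
    (x₁ : Fin n → Vec d) (ξ : Fin n → ℕ → Ω → Ξ) (t : ℕ) :
    Measurable[past ξ t] fun ω => iter ℓ W α x₁ (fun i t => ξ i t ω) t := by
  induction t with
  | zero => exact measurable_const
  | succ t ih =>
    let _ : MeasurableSpace Ω := past ξ (t + 1)
    have hx : Measurable fun ω => iter ℓ W α x₁ (fun i t => ξ i t ω) t :=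
      ih.mono (past_mono ξ t.le_succ) le_rfl
    have hg : ∀ j, Measurable fun ω =>
        stochGrad ℓ (iter ℓ W α x₁ (fun i t => ξ i t ω) t j) (ξ j t ω) := fun j =>
      hO.measurable.comp (((measurable_pi_apply j).comp hx).prodMk (measurable_past ξ j t))
    have hxj : ∀ j, Measurable fun ω => iter ℓ W α x₁ (fun i t => ξ i t ω) t j := fun j =>
      (measurable_pi_apply j).comp hx
    refine measurable_pi_lambda _ fun i => ?_
    change Measurable fun ω => ∑ j, W i j • (iter ℓ W α x₁ (fun i t => ξ i t ω) t j
      - α t • stochGrad ℓ (iter ℓ W α x₁ (fun i t => ξ i t ω) t j) (ξ j t ω))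
    fun_prop

theorem SmoothCosts.measurable_gradient (hS : SmoothCosts ℓ D L) (i : Fin n) :
    Measurable (gradient (localCost ℓ D i)) := by
  have h : LipschitzWith (Real.toNNReal L) (gradient (localCost ℓ D i)) :=
    LipschitzWith.of_dist_le_mul fun x y => by
      rw [dist_eq_norm, dist_eq_norm, Real.coe_toNNReal _ hS.nonneg]
      exact hS.lipschitz i x y
  exact h.continuous.measurable

theorem SmoothCosts.measurable_gradient_globalCost (hS : SmoothCosts ℓ D L) :
    Measurable (gradient (globalCost ℓ D)) := by
  have : gradient (globalCost ℓ D) = fun x => avg fun i => gradient (localCost ℓ D i) x :=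
    funext (gradient_globalCost hS)
  rw [this]
  exact measurable_avg.comp (measurable_pi_lambda _ hS.measurable_gradient)

/-- The compensated noise at the models `x`, for the samples `s`. -/
def stepNoise (ℓ : Vec d → Ξ → ℝ) (D : Fin n → Measure Ξ) (L a κ s2 : ℝ) (x : Fin n → Vec d)
    (s : Fin n → Ξ) : ℝ :=
  noiseTerm L a κ s2 (gradient (globalCost ℓ D) (avg x)) fun i => noise ℓ D i (x i) (s i)

theorem measurable_noise (hO : IsOracle ℓ D) (hS : SmoothCosts ℓ D L) (i : Fin n) :
    Measurable fun p : Vec d × Ξ => noise ℓ D i p.1 p.2 :=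
  hO.measurable.sub ((hS.measurable_gradient i).comp measurable_fst)

theorem measurable_noiseTerm [MeasurableSpace Ω] {v : Ω → Vec d} {z : Ω → Fin n → Vec d}
    (hv : Measurable v) (hz : Measurable z) (L a κ s2 : ℝ) :
    Measurable fun ω => noiseTerm L a κ s2 (v ω) (z ω) := by
  have hz' : Measurable fun ω => avg (z ω) := measurable_avg.comp hz
  have hzi : ∀ i, Measurable fun ω => z ω i := fun i => (measurable_pi_apply i).comp hz
  unfold noiseTerm
  fun_prop

theorem measurable_stepNoise (hO : IsOracle ℓ D) (hS : SmoothCosts ℓ D L) (a κ s2 : ℝ) :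
    Measurable (Function.uncurry (stepNoise ℓ D L a κ s2)) := by
  have hv : Measurable fun p : (Fin n → Vec d) × (Fin n → Ξ) =>
      gradient (globalCost ℓ D) (avg p.1) :=
    hS.measurable_gradient_globalCost.comp (measurable_avg.comp measurable_fst)
  have hp : ∀ i, Measurable fun p : (Fin n → Vec d) × (Fin n → Ξ) => (p.1 i, p.2 i) := fun i =>
    ((measurable_pi_apply i).comp measurable_fst).prodMk
      ((measurable_pi_apply i).comp measurable_snd)
  have hz : Measurable fun (p : (Fin n → Vec d) × (Fin n → Ξ)) i =>
      noise ℓ D i (p.1 i) (p.2 i) :=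
    measurable_pi_lambda _ fun i => (measurable_noise hO hS i).comp (hp i)
  exact measurable_noiseTerm hv hz L a κ s2

/-- The models are frozen at `x`, so the oracle assumptions are needed only at deterministic points.
-/
theorem lintegral_exp_stepNoise_le_one (hn : 0 < n) (hd : 0 < d) {σ : Fin n → ℝ}
    (hO : IsOracle ℓ D) (hS : SmoothCosts ℓ D L) (hU : IsUnbiasedSubGaussian ℓ D σ) {a κ s2 : ℝ}
    (hκ : 0 ≤ κ) (hs2 : s2 = (n : ℝ)⁻¹ * ∑ i, σ i ^ 2) (hdim : 360 * L * a ^ 2 * d * s2 ≤ n)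
    (hκσ : ∀ i, 3 * κ * σ i ^ 2 ≤ 1) (x : Fin n → Vec d) :
    ∫⁻ s, ENNReal.ofReal (Real.exp (stepNoise ℓ D L a κ s2 x s)) ∂(Measure.pi D) ≤ 1 := by
  have := hO.prob
  have hZ : ∀ i, Measurable (noise ℓ D i (x i)) := fun i =>
    Measurable.of_uncurry_left (f := noise ℓ D i) (measurable_noise hO hS i)
  have hint : ∀ i, Integrable (noise ℓ D i (x i)) (D i) := fun i =>
    (hU.integrable i (x i)).sub (integrable_const _)
  have hmean : ∀ i, ∫ s, noise ℓ D i (x i) s ∂(D i) = 0 := fun i => by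
    simp only [noise]
    rw [integral_sub (hU.integrable i (x i)) (integrable_const _), hU.unbiased]
    simp
  exact lintegral_pi_exp_noiseTerm_le_one hn hd hU.nonneg hZ hint hmean
    (fun i => hU.subGaussian i (x i)) hS.nonneg hκ hs2 hdim hκσ _

/-- The samples of iteration `t` are independent of the past and have the product law. -/
theorem IsSampling.map_eq_pi [MeasurableSpace Ω] {μ : Measure Ω} [IsProbabilityMeasure μ]
    {ξ : Fin n → ℕ → Ω → Ξ} (h : IsSampling μ D ξ) (t : ℕ) :
    μ.map (fun ω i => ξ i t ω) = Measure.pi D := by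
  have hi : iIndepFun (fun i => ξ i t) μ :=
    h.indep.precomp (g := fun i : Fin n => (i, t)) fun i j hij => (Prod.mk.inj hij).1
  rw [(iIndepFun_iff_map_fun_eq_pi_map fun i => (h.measurable i t).aemeasurable).1 hi]
  simp_rw [h.law]

theorem IsSampling.past_le [mΩ : MeasurableSpace Ω] {μ : Measure Ω}
    {ξ : Fin n → ℕ → Ω → Ξ} (h : IsSampling μ D ξ) (t : ℕ) : past ξ t ≤ mΩ :=
  iSup₂_le fun p _ => (h.measurable p.1 p.2).comap_le

/-- The index sets `{p.2 < t}` and `{p.2 = t}` are disjoint, so the sigma-algebras they generate are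
independent. -/
theorem IsSampling.indepFun_of_measurable_past [MeasurableSpace Ω] {μ : Measure Ω}
    {ξ : Fin n → ℕ → Ω → Ξ} (h : IsSampling μ D ξ) {t : ℕ} {E : Type*} [MeasurableSpace E]
    {U : Ω → E} (hU : Measurable[past ξ t] U) : IndepFun U (fun ω i => ξ i t ω) μ := by
  rw [IndepFun_iff_Indep]
  have hind := indep_iSup_of_disjoint
    (m := fun p : Fin n × ℕ => MeasurableSpace.comap (ξ p.1 p.2) inferInstance)
    (fun p => (h.measurable p.1 p.2).comap_le) h.indep
    (S := {p | p.2 < t}) (T := {p | p.2 = t})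
    (Set.disjoint_left.2 fun p hp hp' => absurd hp' (ne_of_lt hp))
  refine indep_of_indep_of_le_left (indep_of_indep_of_le_right hind ?_) hU.comap_le
  refine Measurable.comap_le ?_
  refine @measurable_pi_lambda _ _ _ (_) _ _ fun i => Measurable.of_comap_le ?_
  exact le_biSup (fun p : Fin n × ℕ => MeasurableSpace.comap (ξ p.1 p.2) inferInstance)
    (show (i, t) ∈ {p : Fin n × ℕ | p.2 = t} from rfl)

theorem measurable_past_sum_stepNoise (hO : IsOracle ℓ D) (hS : SmoothCosts ℓ D L)
    (W : Matrix (Fin n) (Fin n) ℝ) (α : ℕ → ℝ) (x₁ : Fin n → Vec d) (ξ : Fin n → ℕ → Ω → Ξ)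
    (a κ s2 : ℝ) (t : ℕ) :
    Measurable[past ξ t] fun ω => ∑ r ∈ Finset.range t, stepNoise ℓ D L a κ s2
      (iter ℓ W α x₁ (fun i t => ξ i t ω) r) fun i => ξ i r ω := by
  let _ : MeasurableSpace Ω := past ξ t
  refine Finset.measurable_sum _ fun r hr => ?_
  have hr' : r + 1 ≤ t := Finset.mem_range.1 hr
  have hx : Measurable fun ω => iter ℓ W α x₁ (fun i t => ξ i t ω) r :=
    (hO.measurable_iter W α x₁ ξ r).mono (past_mono ξ (by omega)) le_rfl
  have hs : Measurable fun ω i => ξ i r ω := measurable_pi_lambda _ fun i =>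
    (measurable_past ξ i r).mono (past_mono ξ hr') le_rfl
  exact measurable_apply_of_uncurry (F := stepNoise ℓ D L a κ s2)
    (measurable_stepNoise hO hS a κ s2) hx hs

/-- Supermartingale induction: conditionally on the past, each new factor has mean at most one. -/
theorem lintegral_exp_sum_stepNoise_le_one (hn : 0 < n) (hd : 0 < d) [MeasurableSpace Ω]
    {μ : Measure Ω} [IsProbabilityMeasure μ] {ξ : Fin n → ℕ → Ω → Ξ} {σ : Fin n → ℝ}
    (hO : IsOracle ℓ D) (hS : SmoothCosts ℓ D L) (hU : IsUnbiasedSubGaussian ℓ D σ)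
    (hξ : IsSampling μ D ξ) (W : Matrix (Fin n) (Fin n) ℝ) (α : ℕ → ℝ) (x₁ : Fin n → Vec d)
    {a κ s2 : ℝ} (hκ : 0 ≤ κ) (hs2 : s2 = (n : ℝ)⁻¹ * ∑ i, σ i ^ 2)
    (hdim : 360 * L * a ^ 2 * d * s2 ≤ n) (hκσ : ∀ i, 3 * κ * σ i ^ 2 ≤ 1) (t : ℕ) :
    ∫⁻ ω, ENNReal.ofReal (Real.exp (∑ r ∈ Finset.range t, stepNoise ℓ D L a κ s2
      (iter ℓ W α x₁ (fun i t => ξ i t ω) r) fun i => ξ i r ω)) ∂μ ≤ 1 := by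
  induction t with
  | zero => simp
  | succ t ih =>
    simp_rw [Finset.sum_range_succ]
    have hSm := measurable_past_sum_stepNoise hO hS W α x₁ ξ a κ s2 t
    have hXm := hO.measurable_iter W α x₁ ξ t
    -- The partial sum and the iterate are dependent, so they must be independent of the new samples
    -- as a pair.
    have hSX : Measurable[past ξ t] fun ω => (∑ r ∈ Finset.range t, stepNoise ℓ D L a κ s2
        (iter ℓ W α x₁ (fun i t => ξ i t ω) r) (fun i => ξ i r ω),
        iter ℓ W α x₁ (fun i t => ξ i t ω) t) := by
      let _ : MeasurableSpace Ω := past ξ t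
      exact Measurable.prodMk hSm hXm
    refine (lintegral_exp_add_le_of_indepFun (hSm.mono (hξ.past_le t) le_rfl)
      (hXm.mono (hξ.past_le t) le_rfl) (measurable_pi_lambda _ fun i => hξ.measurable i t)
      (hξ.indepFun_of_measurable_past hSX)
      (measurable_stepNoise hO hS a κ s2) fun x => ?_).trans ih
    rw [hξ.map_eq_pi]
    exact lintegral_exp_stepNoise_le_one hn hd hO hS hU hκ hs2 hdim hκσ x

/-- Markov's inequality for an exponential moment. -/
theorem ofReal_one_sub_le_measure_of_lintegral_exp_le_one [MeasurableSpace Ω] {μ : Measure Ω}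
    [IsProbabilityMeasure μ] {S : Ω → ℝ} (hS : Measurable S)
    (h : ∫⁻ ω, ENNReal.ofReal (Real.exp (S ω)) ∂μ ≤ 1) {δ : ℝ} (hδ : 0 < δ) :
    ENNReal.ofReal (1 - δ) ≤ μ {ω | S ω ≤ Real.log (1 / δ)} := by
  have hM := mul_meas_ge_le_lintegral (μ := μ) (f := fun ω => ENNReal.ofReal (Real.exp (S ω)))
    (by fun_prop) (ENNReal.ofReal (1 / δ))
  have hle : μ {ω | S ω ≤ Real.log (1 / δ)}ᶜ ≤ ENNReal.ofReal δ := by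
    have hsub : {ω | S ω ≤ Real.log (1 / δ)}ᶜ
        ⊆ {ω | ENNReal.ofReal (1 / δ) ≤ ENNReal.ofReal (Real.exp (S ω))} := by
      intro ω hω
      simp only [Set.mem_compl_iff, Set.mem_ofPred_eq, not_le] at hω
      refine ENNReal.ofReal_le_ofReal ?_
      rw [← Real.exp_log (by positivity : 0 < 1 / δ)]
      exact Real.exp_le_exp.2 hω.le
    calc μ {ω | S ω ≤ Real.log (1 / δ)}ᶜ
        ≤ μ {ω | ENNReal.ofReal (1 / δ) ≤ ENNReal.ofReal (Real.exp (S ω))} := measure_mono hsub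
      _ = ENNReal.ofReal δ * (ENNReal.ofReal (1 / δ)
            * μ {ω | ENNReal.ofReal (1 / δ) ≤ ENNReal.ofReal (Real.exp (S ω))}) := by
          rw [← mul_assoc, ← ENNReal.ofReal_mul hδ.le, mul_one_div_cancel hδ.ne']
          simp
      _ ≤ ENNReal.ofReal δ * 1 := by gcongr; exact hM.trans h
      _ = ENNReal.ofReal δ := mul_one _
  have hms : MeasurableSet {ω | S ω ≤ Real.log (1 / δ)} := measurableSet_le hS measurable_const
  have hadd := prob_add_prob_compl (μ := μ) hms
  rw [ENNReal.ofReal_sub _ hδ.le, ENNReal.ofReal_one, tsub_le_iff_right, ← hadd]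
  gcongr

end Iterates

/-! ### Consequences of the step-size choice -/

section Rate

variable {n d T : ℕ} {L A B lam σ σmax C a : ℝ}

/-- The left side of the network condition is nonnegative, hence so is `1 - lam`. -/
theorem StepBound.lam_le_one (h : StepBound n d L B lam σ σmax C) (hL : 0 ≤ L) (hB : 0 ≤ B)
    (hlam : 0 ≤ lam) : lam ≤ 1 := by
  have h1 := h.network
  have h2 : 0 ≤ lam * L * B * Real.sqrt 48 * C := by have := h.pos; positivity
  linarith

theorem StepBound.network_sq_le (h : StepBound n d L B lam σ σmax C) (hL : 0 ≤ L) (hB : 0 ≤ B)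
    (hlam : 0 ≤ lam) (ha : 0 ≤ a) (haC : a ≤ C) :
    48 * (a * lam * L * B) ^ 2 ≤ (1 - lam) ^ 2 := by
  have h1 : lam * L * B * Real.sqrt 48 * a ≤ 1 - lam :=
    (mul_le_mul_of_nonneg_left haC (by positivity)).trans h.network
  have h2 := pow_le_pow_left₀ (by positivity) h1 2
  have h3 : (lam * L * B * Real.sqrt 48 * a) ^ 2 = 48 * (a * lam * L * B) ^ 2 := by
    have := Real.sq_sqrt (show (0 : ℝ) ≤ 48 by norm_num)
    linear_combination (lam * L * B * a) ^ 2 * this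
  linarith

theorem StepBound.dim_sq_le (h : StepBound n d L B lam σ σmax C) (hL : 0 ≤ L) (hσ : 0 ≤ σ)
    (ha : 0 ≤ a) (haC : a ≤ C) : 360 * L * a ^ 2 * d * σ ^ 2 ≤ n := by
  have h1 : 6 * σ * Real.sqrt (10 * d * L) * a ≤ Real.sqrt n :=
    (mul_le_mul_of_nonneg_left haC (by positivity)).trans h.dim
  have h2 := pow_le_pow_left₀ (by positivity) h1 2
  rw [Real.sq_sqrt (by positivity)] at h2
  have h3 : (6 * σ * Real.sqrt (10 * d * L) * a) ^ 2 = 360 * L * a ^ 2 * d * σ ^ 2 := by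
    have := Real.sq_sqrt (show (0 : ℝ) ≤ 10 * d * L by positivity)
    linear_combination (6 * σ * a) ^ 2 * this
  linarith

/-- Cubing clears the fractional powers. The result controls `noiseWeight` against the largest
individual noise parameter. -/
theorem StepBound.networkNoise_cube_le (h : StepBound n d L B lam σ σmax C) (hL : 0 ≤ L)
    (hlam : 0 ≤ lam) (hlam1 : lam ≤ 1) (hσmax : 0 ≤ σmax) (ha : 0 ≤ a) (haC : a ≤ C) :
    9 * (a ^ 3 * L ^ 2 * lam ^ 2 * σmax ^ 2) ≤ n * (1 - lam) ^ 2 := by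
  have hl : 0 ≤ 1 - lam := sub_nonneg.2 hlam1
  have h1 := (mul_le_mul_of_nonneg_left haC (by positivity : 0 ≤ σmax ^ (2 / 3 : ℝ)
    * lam ^ (2 / 3 : ℝ) * L ^ (2 / 3 : ℝ) * (9 : ℝ) ^ (1 / 3 : ℝ))).trans h.networkNoise
  have h2 := pow_le_pow_left₀ (by positivity) h1 3
  have htwo : ∀ x : ℝ, 0 ≤ x → (x ^ (2 / 3 : ℝ)) ^ 3 = x ^ 2 := fun x hx => by
    rw [← Real.rpow_natCast, ← Real.rpow_mul hx, ← Real.rpow_natCast]; norm_num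
  have hone : ∀ x : ℝ, 0 ≤ x → (x ^ (1 / 3 : ℝ)) ^ 3 = x := fun x hx => by
    rw [← Real.rpow_natCast, ← Real.rpow_mul hx]; norm_num
  simp only [mul_pow] at h2
  rw [htwo _ hσmax, htwo _ hlam, htwo _ hL, htwo _ hl, hone _ (by norm_num),
    hone _ (Nat.cast_nonneg n)] at h2
  linarith

theorem stepSize_pos (hn : 0 < n) (hd : 0 < d) (hT : 0 < T) (hσ : 0 ≤ σ) (hC : 0 < C) :
    0 < stepSize n d T σ C := by
  unfold stepSize
  split_ifs with h
  · exact hC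
  · have : 0 < σ := lt_of_le_of_ne hσ (Ne.symm h)
    exact lt_min hC (by positivity)

theorem stepSize_le : stepSize n d T σ C ≤ C := by
  unfold stepSize
  split_ifs
  exacts [le_rfl, min_le_left _ _]

/-- The reciprocal of a minimum is at most the sum of the reciprocals. -/
theorem div_stepSize_mul_le (hn : 0 < n) (hd : 0 < d) (hT : 0 < T) (hσ : 0 ≤ σ) (hC : 0 < C)
    {x : ℝ} (hx : 0 ≤ x) :
    x / (stepSize n d T σ C * T) ≤ x / (C * T) + σ * Real.sqrt d * x / Real.sqrt (n * T) := by
  have hT' : (0 : ℝ) < T := by positivity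
  unfold stepSize
  split_ifs with h
  · simp [h]
  have hσ' : 0 < σ := lt_of_le_of_ne hσ (Ne.symm h)
  rcases min_choice C (Real.sqrt n / (σ * Real.sqrt (d * T))) with hm | hm
  · rw [hm]
    have : 0 ≤ σ * Real.sqrt d * x / Real.sqrt (n * T) := by positivity
    linarith
  · rw [hm]
    have h1 : x / (Real.sqrt n / (σ * Real.sqrt (d * T)) * T)
        = σ * Real.sqrt d * x / Real.sqrt (n * T) := by
      rw [Real.sqrt_mul (by positivity), Real.sqrt_mul (by positivity)]
      have hs : Real.sqrt T ^ 2 = T := Real.sq_sqrt hT'.le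
      have hs0 : 0 < Real.sqrt T := Real.sqrt_pos.2 hT'
      have hn0 : 0 < Real.sqrt n := Real.sqrt_pos.2 (by positivity)
      nth_rewrite 2 [← hs]
      field_simp
    have : 0 ≤ x / (C * T) := by positivity
    linarith

theorem stepSize_mul_sq_le (hn : 0 < n) (hd : 0 < d) (hT : 0 < T) (hσ : 0 ≤ σ)
    (hL : 0 ≤ L) :
    L * stepSize n d T σ C * d * σ ^ 2 / n ≤ σ * Real.sqrt d * L / Real.sqrt (n * T) := by
  have hT' : (0 : ℝ) < T := by positivity
  rcases hσ.eq_or_lt with h | hσ'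
  · simp [← h]
  have hle : stepSize n d T σ C ≤ Real.sqrt n / (σ * Real.sqrt (d * T)) := by
    unfold stepSize
    rw [if_neg hσ'.ne']
    exact min_le_right _ _
  calc L * stepSize n d T σ C * d * σ ^ 2 / n
      ≤ L * (Real.sqrt n / (σ * Real.sqrt (d * T))) * d * σ ^ 2 / n := by gcongr
    _ = σ * Real.sqrt d * L / Real.sqrt (n * T) := by
      rw [Real.sqrt_mul (by positivity), Real.sqrt_mul (by positivity)]
      have hs0 : 0 < Real.sqrt T := Real.sqrt_pos.2 hT'
      have hn0 : 0 < Real.sqrt n := Real.sqrt_pos.2 (by positivity)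
      have hd0 : 0 < Real.sqrt d := Real.sqrt_pos.2 (by positivity)
      have hn2 : Real.sqrt n ^ 2 = n := Real.sq_sqrt (by positivity)
      have hd2 : Real.sqrt d ^ 2 = d := Real.sq_sqrt (by positivity)
      field_simp
      rw [hn2, hd2]
      ring

/-- For `σ > 0`, `a² ≤ n / (σ² d T)`. For `σ = 0` the right side is a division by zero, read as `0`,
and the left side vanishes because `A = 0`. -/
theorem stepSize_sq_mul_le (hn : 0 < n) (hd : 0 < d) (hT : 0 < T) (hσ : 0 ≤ σ) (hC : 0 < C)
    (hA : σ = 0 → A = 0) (hlam : lam < 1) :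
    stepSize n d T σ C ^ 2 * L ^ 2 * lam ^ 2 / (1 - lam) ^ 2 * (A ^ 2 + σ ^ 2)
      ≤ n * lam ^ 2 * L ^ 2 * (A ^ 2 + σ ^ 2) / (σ ^ 2 * d * (1 - lam) ^ 2 * T) := by
  have hT' : (0 : ℝ) < T := by positivity
  have hl : 0 < 1 - lam := by linarith
  rcases hσ.eq_or_lt with h | hσ'
  · simp [← h, hA h.symm]
  have hle : stepSize n d T σ C ≤ Real.sqrt n / (σ * Real.sqrt (d * T)) := by
    unfold stepSize
    rw [if_neg hσ'.ne']
    exact min_le_right _ _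
  have hsq := pow_le_pow_left₀ (stepSize_pos hn hd hT hσ hC).le hle 2
  rw [div_pow, mul_pow, Real.sq_sqrt (by positivity), Real.sq_sqrt (by positivity)] at hsq
  calc stepSize n d T σ C ^ 2 * L ^ 2 * lam ^ 2 / (1 - lam) ^ 2 * (A ^ 2 + σ ^ 2)
      ≤ (n / (σ ^ 2 * (d * T))) * L ^ 2 * lam ^ 2 / (1 - lam) ^ 2 * (A ^ 2 + σ ^ 2) := by gcongr
    _ = _ := by field_simp

theorem rate_nonneg {Δf Δx δ : ℝ} (hσ : 0 ≤ σ) (hL : 0 ≤ L) (hC : 0 ≤ C) (hlam : 0 ≤ lam)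
    (hlam1 : lam ≤ 1) (hf : 0 ≤ Δf + Real.log (1 / δ)) (hx : 0 ≤ Δx) :
    0 ≤ rate n d T L A lam σ C Δf Δx δ := by
  have h1 : 0 ≤ 1 - lam ^ 2 := by nlinarith
  have h2 : 0 ≤ Δf + Real.log (1 / δ) + L := by linarith
  unfold rate
  positivity

/-- The bound obtained from the one-step analysis is at most a multiple of the rate. -/
theorem le_rate (hn : 0 < n) (hd : 0 < d) (hT : 0 < T) (hσ : 0 ≤ σ) (hC : 0 < C) (hL : 0 ≤ L)
    (hlam : 0 ≤ lam) (hlam1 : lam < 1) (hA : σ = 0 → A = 0) {Δf Δx δ Q : ℝ}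
    (hf : 0 ≤ Δf + Real.log (1 / δ)) (hx : 0 ≤ Δx)
    (hQ : 5 / 132 * stepSize n d T σ C * (T * Q) ≤ Δf + Real.log (1 / δ)
      + 12 / 11 * (stepSize n d T σ C * L ^ 2) / (1 - lam) * Δx
      + T * (noiseWeight n L lam (stepSize n d T σ C) * (n * (A ^ 2 + σ ^ 2))
        + 4 * L * stepSize n d T σ C ^ 2 * d * σ ^ 2 / n)) :
    Q ≤ 120 * rate n d T L A lam σ C Δf Δx δ := by
  have hT' : (0 : ℝ) < T := by positivity
  have hn' : (0 : ℝ) < n := by positivity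
  have ha := stepSize_pos hn hd hT hσ hC
  have hl : 0 < 1 - lam := by linarith
  have hl2 : 0 < 1 - lam ^ 2 := by nlinarith
  have h1 := div_stepSize_mul_le hn hd hT hσ hC hf
  have h2 := stepSize_mul_sq_le (C := C) hn hd hT hσ hL
  have h3 := stepSize_sq_mul_le (L := L) hn hd hT hσ hC hA hlam1
  -- `1 - lam² = (1 - lam)(1 + lam)` with `1 + lam ≤ 2`.
  have h4 : L ^ 2 * Δx / ((1 - lam) * T) ≤ 2 * (L ^ 2 * Δx / ((1 - lam ^ 2) * T)) := by
    rw [← mul_div_assoc, div_le_div_iff₀ (by positivity) (by positivity)]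
    have : 0 ≤ L ^ 2 * Δx * T * (1 - lam) ^ 2 := by positivity
    nlinarith
  set a := stepSize n d T σ C
  have h5 : Q ≤ 132 / 5 * ((Δf + Real.log (1 / δ)) / (a * T)
      + 12 / 11 * (L ^ 2 * Δx / ((1 - lam) * T))
      + 24 / 11 * (a ^ 2 * L ^ 2 * lam ^ 2 / (1 - lam) ^ 2 * (A ^ 2 + σ ^ 2))
      + 4 * (L * a * d * σ ^ 2 / n)) := by
    have h6 : 5 / 132 * a * (T * (132 / 5 * ((Δf + Real.log (1 / δ)) / (a * T)
      + 12 / 11 * (L ^ 2 * Δx / ((1 - lam) * T))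
      + 24 / 11 * (a ^ 2 * L ^ 2 * lam ^ 2 / (1 - lam) ^ 2 * (A ^ 2 + σ ^ 2))
      + 4 * (L * a * d * σ ^ 2 / n)))) = Δf + Real.log (1 / δ)
      + 12 / 11 * (a * L ^ 2) / (1 - lam) * Δx
      + T * (noiseWeight n L lam a * (n * (A ^ 2 + σ ^ 2)) + 4 * L * a ^ 2 * d * σ ^ 2 / n) := by
      unfold noiseWeight
      field_simp
      ring
    rw [← h6] at hQ
    exact le_of_mul_le_mul_left (le_of_mul_le_mul_left hQ (by positivity)) hT'
  have h7 : 0 ≤ σ * Real.sqrt d * (Δf + Real.log (1 / δ)) / Real.sqrt (n * T) := by positivity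
  have h8 : 0 ≤ (Δf + Real.log (1 / δ)) / (C * T) := by positivity
  have h9 : 0 ≤ L ^ 2 * Δx / ((1 - lam ^ 2) * T) := by positivity
  have h10 : 0 ≤ n * lam ^ 2 * L ^ 2 * (A ^ 2 + σ ^ 2) / (σ ^ 2 * d * (1 - lam) ^ 2 * T) := by
    positivity
  have h11 : 0 ≤ σ * Real.sqrt d * L / Real.sqrt (n * T) := by positivity
  have h12 : σ * Real.sqrt d * (Δf + Real.log (1 / δ) + L) / Real.sqrt (n * T)
      = σ * Real.sqrt d * (Δf + Real.log (1 / δ)) / Real.sqrt (n * T)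
        + σ * Real.sqrt d * L / Real.sqrt (n * T) := by ring
  unfold rate
  rw [h12]
  -- The factor `132/5` turns the coefficients into `26.4`, `57.6`, `57.6` and `105.6`, all below
  -- `120`.
  linarith

end Rate

/-! ### Telescoping, the degenerate case, and the conclusion -/

section Main

variable {n d T : ℕ} {Ξ Ω : Type*} [MeasurableSpace Ξ] {ℓ : Vec d → Ξ → ℝ} {D : Fin n → Measure Ξ}
  {W : Matrix (Fin n) (Fin n) ℝ} {L A B a s2 : ℝ}

theorem iter_succ_eq_mixStep (α : ℕ → ℝ) (x₁ : Fin n → Vec d) (ξ : Fin n → ℕ → Ξ) (t : ℕ) :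
    iter ℓ W α x₁ ξ (t + 1) = mixStep W (α t) (iter ℓ W α x₁ ξ t) fun i =>
      gradient (localCost ℓ D i) (iter ℓ W α x₁ ξ t i)
        + noise ℓ D i (iter ℓ W α x₁ ξ t i) (ξ i t) := by
  funext i
  simp [iter, mixStep, noise]

/-- The one-step analysis, summed over the iterations. -/
theorem sum_potential_le (hn : 2 ≤ n) (hW : W ∈ doublyStochastic ℝ (Fin n))
    (hlam : secondSingularValue W < 1) (hS : SmoothCosts ℓ D L) (hH : BoundedHeterogeneity ℓ D A B)
    (ha : 0 ≤ a) (haL : 2 * L * a ≤ 1) (has : 9 * s2 * a ≤ n)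
    (hnet : 48 * (a * secondSingularValue W * L * B) ^ 2 ≤ (1 - secondSingularValue W) ^ 2)
    (x₁ : Fin n → Vec d) (ξ : Fin n → ℕ → Ξ) (T : ℕ) :
    5 / 132 * a * ∑ t ∈ Finset.range T, ((n : ℝ)⁻¹ * ∑ i,
        ‖gradient (globalCost ℓ D) (iter ℓ W (fun _ => a) x₁ ξ t i)‖ ^ 2)
        + potential ℓ D L (secondSingularValue W) a (iter ℓ W (fun _ => a) x₁ ξ T)
      ≤ potential ℓ D L (secondSingularValue W) a x₁
        + T * (noiseWeight n L (secondSingularValue W) a * (n * (A ^ 2 + s2))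
          + 4 * L * a ^ 2 * d * s2 / n)
        + ∑ t ∈ Finset.range T, stepNoise ℓ D L a (noiseWeight n L (secondSingularValue W) a) s2
            (iter ℓ W (fun _ => a) x₁ ξ t) fun i => ξ i t := by
  induction T with
  | zero => simp [iter]
  | succ T ih =>
    have h := potential_mixStep_le hn hW hlam hS hH ha haL has hnet
      (iter ℓ W (fun _ => a) x₁ ξ T)
      fun i => noise ℓ D i (iter ℓ W (fun _ => a) x₁ ξ T i) (ξ i T)
    rw [← iter_succ_eq_mixStep (fun _ => a)] at h
    rw [Finset.sum_range_succ, Finset.sum_range_succ, mul_add (5 / 132 * a)]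
    simp only [stepNoise] at ih ⊢
    push_cast
    linarith

/-- A function with constant gradient that is bounded below has zero gradient. -/
theorem gradient_eq_zero_of_bddBelow {f : Vec d → ℝ} (hf : Differentiable ℝ f)
    (hconst : ∀ x y, gradient f x = gradient f y) (hb : BddBelow (Set.range f)) (x : Vec d) :
    gradient f x = 0 := by
  obtain ⟨m, hm⟩ := hb
  by_contra hg
  have hpos : 0 < ‖gradient f x‖ ^ 2 := by positivity
  -- The step length is chosen so that the linear bound reaches `m - 1`, below the lower bound `m`.
  have h1 := le_quadratic_of_lipschitz_gradient (L := 0) hf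
    (fun y z => by rw [hconst y z]; simp) x (-((f x - m + 1) / ‖gradient f x‖ ^ 2) • gradient f x)
  rw [inner_smul_right, real_inner_self_eq_norm_sq, neg_mul, div_mul_cancel₀ _ hpos.ne'] at h1
  have h2 := hm (Set.mem_range_self (x + -((f x - m + 1) / ‖gradient f x‖ ^ 2) • gradient f x))
  linarith

theorem le_sigmaMax (σ : Fin n → ℝ) (i : Fin n) : σ i ≤ sigmaMax σ :=
  le_ciSup (Set.finite_range σ).bddAbove i

theorem sigmaAvg_sq (σ : Fin n → ℝ) : sigmaAvg σ ^ 2 = (n : ℝ)⁻¹ * ∑ i, σ i ^ 2 :=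
  Real.sq_sqrt (by positivity)

/-- If the second singular value is one, the step-size conditions leave only costs with vanishing
gradient. -/
theorem gradient_globalCost_eq_zero_of_secondSingularValue_eq_one (hn : 2 ≤ n)
    (hlam : secondSingularValue W = 1) (hb : BddBelow (Set.range (globalCost ℓ D)))
    (hS : SmoothCosts ℓ D L) {σ : Fin n → ℝ} (hσ : ∀ i, 0 ≤ σ i)
    (hH : BoundedHeterogeneity ℓ D A B) (hA : sigmaAvg σ = 0 → A = 0) {C : ℝ}
    (hC : StepBound n d L B (secondSingularValue W) (sigmaAvg σ) (sigmaMax σ) C) (x : Vec d) :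
    gradient (globalCost ℓ D) x = 0 := by
  have hn0 : 0 < n := by omega
  have hCpos := hC.pos
  have hσmax : 0 ≤ sigmaMax σ := (hσ ⟨0, hn0⟩).trans (le_sigmaMax σ _)
  have h1 := hC.network_sq_le hS.nonneg hH.nonneg_B (secondSingularValue_nonneg W) hCpos.le le_rfl
  have h2 := hC.networkNoise_cube_le hS.nonneg (secondSingularValue_nonneg W) hlam.le hσmax
    hCpos.le le_rfl
  -- Both right sides become zero, so `L B = 0` and `L σmax = 0`. Either `L = 0` and the gradient is
  -- constant, or `B`, all `σᵢ` and hence `A` vanish.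
  rw [hlam] at h1 h2
  rcases hS.nonneg.eq_or_lt with hL | hL
  · refine gradient_eq_zero_of_bddBelow (fun y => (hasGradientAt_globalCost hS y).differentiableAt)
      (fun y z => ?_) hb x
    have := norm_gradient_globalCost_sub_le hn0 hS y z
    rw [← hL, zero_mul, norm_le_zero_iff, sub_eq_zero] at this
    exact this
  · have hB : B = 0 := by
      by_contra hB
      have hBpos : 0 < B := lt_of_le_of_ne hH.nonneg_B (Ne.symm hB)
      have : 0 < 48 * (C * 1 * L * B) ^ 2 := by positivity
      linarith
    have hs : sigmaMax σ = 0 := by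
      by_contra hs
      have hspos : 0 < sigmaMax σ := lt_of_le_of_ne hσmax (Ne.symm hs)
      have : 0 < 9 * (C ^ 3 * L ^ 2 * 1 ^ 2 * sigmaMax σ ^ 2) := by positivity
      linarith
    have hzero : ∀ i, σ i = 0 := fun i => le_antisymm (hs ▸ le_sigmaMax σ i) (hσ i)
    have hA0 : A = 0 := hA (by simp [sigmaAvg, hzero])
    have hloc : ∀ i, gradient (localCost ℓ D i) x = 0 := fun i => by
      have := hH.bound i x
      rw [hA0, hB] at this
      rw [← norm_eq_zero, ← sq_eq_zero_iff]
      exact le_antisymm (by simpa using this) (sq_nonneg _)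
    rw [gradient_globalCost hS]
    simp [avg, hloc]

/-- On the event that the accumulated noise is at most `log (1/δ)`, the rate holds. -/
theorem avgGradSq_le_rate (hn : 2 ≤ n) (hd : 0 < d) (hW : W ∈ doublyStochastic ℝ (Fin n))
    (hlam : secondSingularValue W < 1) (hb : BddBelow (Set.range (globalCost ℓ D)))
    (hS : SmoothCosts ℓ D L) (hH : BoundedHeterogeneity ℓ D A B) {s : ℝ} (hs : 0 ≤ s)
    (hA : s = 0 → A = 0) {C smax : ℝ} (hC : StepBound n d L B (secondSingularValue W) s smax C)
    (hT : 0 < T) {δ : ℝ} (hδ0 : 0 < δ) (hδ1 : δ < 1) (x₁ : Fin n → Vec d) (ξ : Fin n → ℕ → Ξ)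
    (hξ : ∑ t ∈ Finset.range T, stepNoise ℓ D L (stepSize n d T s C)
      (noiseWeight n L (secondSingularValue W) (stepSize n d T s C)) (s ^ 2)
      (iter ℓ W (fun _ => stepSize n d T s C) x₁ ξ t) (fun i => ξ i t) ≤ Real.log (1 / δ)) :
    avgGradSq ℓ D T (iter ℓ W (fun _ => stepSize n d T s C) x₁ ξ)
      ≤ 120 * rate n d T L A (secondSingularValue W) s C (gapF ℓ D x₁) (gapX x₁) δ := by
  have hn0 : 0 < n := by omega
  have hT' : (0 : ℝ) < T := by positivity
  have ha := stepSize_pos hn0 hd hT hs hC.pos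
  have haC : stepSize n d T s C ≤ C := stepSize_le
  have hl : 0 < 1 - secondSingularValue W := by linarith
  have hlam0 := secondSingularValue_nonneg W
  have hL := hS.nonneg
  have hsum := sum_potential_le hn hW hlam hS hH ha.le (s2 := s ^ 2)
    ((mul_le_mul_of_nonneg_left haC (by positivity)).trans hC.smooth)
    ((mul_le_mul_of_nonneg_left haC (by positivity)).trans hC.noise)
    (hC.network_sq_le hL hH.nonneg_B hlam0 ha.le haC) x₁ ξ T
  have hgap : 0 ≤ gapF ℓ D x₁ := sub_nonneg.2 (ciInf_le hb _)
  have hlog : 0 ≤ Real.log (1 / δ) := Real.log_nonneg (by rw [le_div_iff₀ hδ0]; linarith)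
  refine le_rate hn0 hd hT hs hC.pos hL hlam0 hlam hA (by linarith) (gapX_nonneg x₁) ?_
  have hQ : T * avgGradSq ℓ D T (iter ℓ W (fun _ => stepSize n d T s C) x₁ ξ)
      = ∑ t ∈ Finset.range T, ((n : ℝ)⁻¹ * ∑ i,
        ‖gradient (globalCost ℓ D) (iter ℓ W (fun _ => stepSize n d T s C) x₁ ξ t i)‖ ^ 2) := by
    rw [avgGradSq, ← Finset.mul_sum, mul_inv]
    field_simp
  rw [hQ]
  -- The final potential is bounded below by the infimum of the cost, so telescoping leaves only the
  -- initial gaps.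
  have hfinal : ⨅ x, globalCost ℓ D x ≤ potential ℓ D L (secondSingularValue W)
      (stepSize n d T s C) (iter ℓ W (fun _ => stepSize n d T s C) x₁ ξ T) := by
    refine (ciInf_le hb _).trans (le_add_of_nonneg_right ?_)
    have := gapX_nonneg (iter ℓ W (fun _ => stepSize n d T s C) x₁ ξ T)
    positivity
  unfold gapF
  rw [show potential ℓ D L (secondSingularValue W) (stepSize n d T s C) x₁
    = globalCost ℓ D (avg x₁) + 12 / 11 * (stepSize n d T s C * L ^ 2)
      / (1 - secondSingularValue W) * gapX x₁ from rfl] at hsum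
  linarith

end Main

end DSGD

end

theorem theorem1 :
    ∃ K : ℝ, 0 < K ∧
      ∀ (n d : ℕ), 2 ≤ n → 0 < d →
      ∀ (Ω : Type*) [MeasurableSpace Ω] (μ : Measure Ω) [IsProbabilityMeasure μ]
        (Ξ : Type*) [MeasurableSpace Ξ]
        (ℓ : DSGD.Vec d → Ξ → ℝ) (D : Fin n → Measure Ξ) (ξ : Fin n → ℕ → Ω → Ξ)
        (W : Matrix (Fin n) (Fin n) ℝ) (x₁ : Fin n → DSGD.Vec d)
        (L A B : ℝ) (σ : Fin n → ℝ),
        DSGD.IsOracle ℓ D →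
        DSGD.IsCommunicationMatrix W →
        BddBelow (Set.range (DSGD.globalCost ℓ D)) →
        DSGD.SmoothCosts ℓ D L →
        DSGD.IsSampling μ D ξ →
        DSGD.IsUnbiasedSubGaussian ℓ D σ →
        DSGD.BoundedHeterogeneity ℓ D A B →
        -- for `σ = 0 < A` the rate is infinite and nothing is claimed
        (DSGD.sigmaAvg σ = 0 → A = 0) →
        ∀ (C : ℝ),
          DSGD.StepBound n d L B (DSGD.secondSingularValue W) (DSGD.sigmaAvg σ)
            (DSGD.sigmaMax σ) C →
        ∀ (T : ℕ), 1 ≤ T → ∀ (δ : ℝ), 0 < δ → δ < 1 →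
          ENNReal.ofReal (1 - δ) ≤
            μ {ω | DSGD.avgGradSq ℓ D T
                (DSGD.iter ℓ W (fun _ => DSGD.stepSize n d T (DSGD.sigmaAvg σ) C) x₁
                  (fun i t => ξ i t ω))
              ≤ K * DSGD.rate n d T L A (DSGD.secondSingularValue W) (DSGD.sigmaAvg σ) C
                  (DSGD.gapF ℓ D x₁) (DSGD.gapX x₁) δ} := by
  refine ⟨120, by norm_num, ?_⟩
  intro n d hn hd Ω _ μ _ Ξ _ ℓ D ξ W x₁ L A B σ hO hW hb hS hξ hU hH hA C hC T hT δ hδ0 hδ1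
  have hn0 : 0 < n := by omega
  have hn' : (0 : ℝ) < n := by positivity
  have hlam0 := DSGD.secondSingularValue_nonneg W
  have hs : 0 ≤ DSGD.sigmaAvg σ := Real.sqrt_nonneg _
  have hlam1 := hC.lam_le_one hS.nonneg hH.nonneg_B hlam0
  rcases hlam1.eq_or_lt with hlam | hlam
  -- For `λ = 1` the left side vanishes on every sample path, and the rate is still nonnegative
  -- because its quotients with zero denominator are `0`.
  · have hzero := DSGD.gradient_globalCost_eq_zero_of_secondSingularValue_eq_one hn hlam hb hS
      hU.nonneg hH hA hC
    have hgap : 0 ≤ DSGD.gapF ℓ D x₁ := sub_nonneg.2 (ciInf_le hb _)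
    have hlog : 0 ≤ Real.log (1 / δ) := Real.log_nonneg (by rw [le_div_iff₀ hδ0]; linarith)
    have hrate := DSGD.rate_nonneg (n := n) (d := d) (T := T) (A := A) (δ := δ) hs hS.nonneg
      hC.pos.le hlam0 hlam1 (by linarith : 0 ≤ DSGD.gapF ℓ D x₁ + Real.log (1 / δ))
      (DSGD.gapX_nonneg x₁)
    refine (ENNReal.ofReal_le_one.2 (by linarith)).trans ?_
    rw [← measure_univ (μ := μ)]
    refine measure_mono fun ω _ => ?_
    have hlhs : DSGD.avgGradSq ℓ D T (DSGD.iter ℓ W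
        (fun _ => DSGD.stepSize n d T (DSGD.sigmaAvg σ) C) x₁ fun i t => ξ i t ω) = 0 := by
      simp [DSGD.avgGradSq, hzero]
    exact hlhs.le.trans (mul_nonneg (by norm_num) hrate)
  · have ha := DSGD.stepSize_pos hn0 hd hT hs hC.pos
    have haC : DSGD.stepSize n d T (DSGD.sigmaAvg σ) C ≤ C := DSGD.stepSize_le
    have hl : 0 < 1 - DSGD.secondSingularValue W := by linarith
    have hσmax : 0 ≤ DSGD.sigmaMax σ := (hU.nonneg ⟨0, hn0⟩).trans (DSGD.le_sigmaMax σ _)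
    set a := DSGD.stepSize n d T (DSGD.sigmaAvg σ) C
    set κ := DSGD.noiseWeight n L (DSGD.secondSingularValue W) a with hκ_def
    have hκ : 0 ≤ κ := by
      rw [hκ_def, DSGD.noiseWeight]
      positivity
    have hκσ : ∀ i, 3 * κ * σ i ^ 2 ≤ 1 := by
      intro i
      -- The constant `9` of the step-size condition covers `3 · 24/11 = 72/11`.
      have h1 := hC.networkNoise_cube_le hS.nonneg hlam0 hlam1 hσmax ha.le haC
      have h2 : σ i ^ 2 ≤ DSGD.sigmaMax σ ^ 2 :=
        pow_le_pow_left₀ (hU.nonneg i) (DSGD.le_sigmaMax σ i) 2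
      have h3 : 3 * κ * σ i ^ 2 ≤ 3 * κ * DSGD.sigmaMax σ ^ 2 := by gcongr
      refine h3.trans ?_
      have h4 : 3 * κ * DSGD.sigmaMax σ ^ 2
          = 72 / 11 * (a ^ 3 * L ^ 2 * DSGD.secondSingularValue W ^ 2 * DSGD.sigmaMax σ ^ 2)
            / (n * (1 - DSGD.secondSingularValue W) ^ 2) := by
        rw [hκ_def, DSGD.noiseWeight]
        ring
      rw [h4, div_le_one (by positivity)]
      have h5 : 0 ≤ a ^ 3 * L ^ 2 * DSGD.secondSingularValue W ^ 2 * DSGD.sigmaMax σ ^ 2 := by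
        positivity
      linarith
    have hexp := DSGD.lintegral_exp_sum_stepNoise_le_one hn0 hd hO hS hU hξ W (fun _ => a) x₁ hκ
      (DSGD.sigmaAvg_sq σ) (hC.dim_sq_le hS.nonneg hs ha.le haC) hκσ T
    have hmeas := (DSGD.measurable_past_sum_stepNoise hO hS W (fun _ => a) x₁ ξ a κ
      (DSGD.sigmaAvg σ ^ 2) T).mono (hξ.past_le T) le_rfl
    refine (DSGD.ofReal_one_sub_le_measure_of_lintegral_exp_le_one hmeas hexp hδ0).trans
      (measure_mono fun ω hω => ?_)
    exact DSGD.avgGradSq_le_rate hn hd hW.doublyStochastic hlam hb hS hH hs hA hC hT hδ0 hδ1 x₁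
      (fun i t => ξ i t ω) hω
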